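/- Let $A$ be a unital graded-commutative dg algebra over $\mathbb R$ (unbounded, differentials of degree $+1$), let $T_A$ be its dg Lie algebra of derivations, and let $(\mathfrak g, d, [-,-],\rho\colon\mathfrak g\to T_A)$ be a dg Lie algebroid over $A$ which is fibrant (the anchor $\rho$ is degreewise surjective) and for which $\ker\rho$ is abelian (its bracket vanishes). For $n\ge 0$ let $C_*(\Delta^n;\mathbb R)$ be the normalised chain complex, with a basis element in degree $-l$ for each injective monotone map $\varphi\colon[l]\hookrightarrow[n]$, and let $$\widehat{\mathfrak g}_n=\mathrm{Hom}_{T_A}\big(C_*(\Delta^n;\mathbb R),\mathfrak g\big)\subset \mathrm{Hom}_{\mathbb R}\big(C_*(\Delta^n;\mathbb R),\mathfrak g\big)$$ be the dg $A$-submodule of the hom complex (with $A$ acting on values) of those $f$ with $\rho(f(\varphi))=0$ for all $\varphi\colon[l]\hookrightarrow[n]$ with $l>0$ and $\rho(f(0))=\dots=\rho(f(n))$ on the vertices; this common value is the anchor $\widehat\rho(f)$. Write $(y,\psi)$ for the map with value $y$ on $\psi$ and zero on all other basis elements, so that $|(y,\psi)|=|y|+l$ for $\psi\colon[l]\hookrightarrow[n]$.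 Equip $\widehat{\mathfrak g}_n$ with the graded antisymmetric bilinear bracket determined by $$\Big[\sum_i (x_i,i),\sum_i(y_i,i)\Big]=\sum_i([x_i,y_i],i),\qquad \Big[\sum_i(x_i,i),(y,\psi)\Big]=\frac1{l+1}\sum_{i=0}^l\big([x_{\psi(i)},y],\psi\big)\quad(\psi\colon[l]\hookrightarrow[n],\ l>0),$$ and by $[(y,\psi),(y',\psi')]=0$ if $\psi,\psi'$ both have positive-dimensional domain. With the structure maps induced by the functoriality of $C_*(\Delta^n;\mathbb R)$ in $[n]$, the $\widehat{\mathfrak g}_n$ form a simplicial dg Lie algebroid $\widehat{\mathfrak g}$ over $A$, and $\widehat{\mathfrak g}$ is a Reedy-fibrant simplicial resolution of $\mathfrak g$ in the category of $L_\infty$-algebroids over $A$ and strict maps, with its semi-model structure in which the weak equivalences are the quasi-isomorphisms and the fibrations are the degreewise surjective maps. That is: 1. for every $n\ge0$ the matching object $M_n\widehat{\mathfrak g}$ (the limit, in $L_\infty$-algebroids over $A$, of the values of $\widehat{\mathfrak g}$ on the proper faces of $[n]$) exists and $\widehat{\mathfrak g}_n\to M_n\widehat{\mathfrak g}$ is degreewise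 surjective; 2. the canonical map $\mathfrak g\to\widehat{\mathfrak g}_n$ from the constant simplicial object, $x\mapsto\sum_{i}(x,i)$, is a quasi-isomorphism for every $n\ge0$. -/

import Mathlib

open CategoryTheory HomotopicalAlgebra

universe u

/-! ### Graded real vector spaces

A graded vector space is a real vector space `M` with a family of submodules `gr k`, `k : ℤ`,
of which it is the direct sum. Signs are written as the real numbers `(-1) ^ k`. -/

section Grading

variable {M : Type*} [AddCommGroup M] [Module ℝ M] (gr : ℤ → Submodule ℝ M)
  [DirectSum.Decomposition gr]

/-- The projection of a graded vector space to its part of degree `k`. -/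
noncomputable def gradedProj (k : ℤ) : M →ₗ[ℝ] M :=
  (gr k).subtype ∘ₗ DirectSum.component ℝ ℤ (fun i => gr i) k ∘ₗ
    (DirectSum.decomposeLinearEquiv gr).toLinearMap

/-- The involution `x ↦ (-1) ^ |x| • x` of a graded vector space. -/
noncomputable def gradedSign : M →ₗ[ℝ] M :=
  DirectSum.toModule ℝ ℤ M (fun k => (-1 : ℝ) ^ k • (gr k).subtype) ∘ₗ
    (DirectSum.decomposeLinearEquiv gr).toLinearMap

variable {gr}

theorem gradedProj_apply (k : ℤ) (x : M) :
    gradedProj gr k x = (DirectSum.decompose gr x k : M) := rfl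

theorem gradedProj_mem (k : ℤ) (x : M) : gradedProj gr k x ∈ gr k :=
  (DirectSum.decompose gr x k).2

theorem gradedProj_same {k : ℤ} {x : M} (hx : x ∈ gr k) : gradedProj gr k x = x :=
  DirectSum.decompose_of_mem_same gr hx

theorem gradedProj_ne {k j : ℤ} {x : M} (hx : x ∈ gr k) (h : k ≠ j) : gradedProj gr j x = 0 :=
  DirectSum.decompose_of_mem_ne gr hx h

theorem gradedSign_of_mem {k : ℤ} {x : M} (hx : x ∈ gr k) :
    gradedSign gr x = (-1 : ℝ) ^ k • x := by
  have h : DirectSum.decomposeLinearEquiv gr x = DirectSum.lof ℝ ℤ (fun i => gr i) k ⟨x, hx⟩ :=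
    DirectSum.decompose_of_mem gr hx
  simp [gradedSign, h, DirectSum.toModule_lof]

theorem gradedSign_pow_of_mem (m : ℕ) {k : ℤ} {x : M} (hx : x ∈ gr k) :
    (gradedSign gr ^ m) x = (-1 : ℝ) ^ (m * k) • x := by
  induction m with
  | zero => simp
  | succ m ih =>
    rw [pow_succ', Module.End.mul_apply, ih, map_smul, gradedSign_of_mem hx, smul_smul,
      ← zpow_add₀ (by norm_num)]
    congr 2
    push_cast
    ring

/-- Induction on sums of homogeneous elements. -/
@[elab_as_elim]
theorem graded_induction {p : M → Prop} (h0 : p 0) (hadd : ∀ x y, p x → p y → p (x + y))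
    (hm : ∀ k, ∀ x ∈ gr k, p x) (x : M) : p x :=
  DirectSum.Decomposition.inductionOn gr h0 (fun m => hm _ m.1 m.2) hadd x

theorem finite_gradedProj (x : M) :
    ∃ S : Finset ℤ, ∀ T : Finset ℤ, S ⊆ T → ∑ k ∈ T, gradedProj gr k x = x := by
  classical
  refine ⟨DFinsupp.support (DirectSum.decompose gr x), fun T hT => ?_⟩
  conv_rhs => rw [← DirectSum.sum_support_decompose gr x]
  refine (Finset.sum_subset hT fun k _ hk => ?_).symm
  rw [gradedProj_apply]
  simpa using hk

end Grading

/-- A criterion for a family of submodules to be a grading, through its projections. -/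
theorem isInternal_of_proj {M : Type*} [AddCommGroup M] [Module ℝ M] (gr : ℤ → Submodule ℝ M)
    (P : ℤ → M →ₗ[ℝ] M) (hm : ∀ k x, P k x ∈ gr k) (hs : ∀ k, ∀ x ∈ gr k, P k x = x)
    (hn : ∀ k j, k ≠ j → ∀ x ∈ gr k, P j x = 0)
    (hf : ∀ x, ∃ S : Finset ℤ, ∑ k ∈ S, P k x = x) : DirectSum.IsInternal gr := by
  classical
  constructor
  · have key : ∀ (v : DirectSum ℤ fun i => gr i) (k : ℤ),
        P k (DirectSum.coeAddMonoidHom gr v) = (v k : M) := by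
      intro v k
      induction v using DirectSum.induction_on with
      | zero => simp
      | of i x =>
        rw [DirectSum.coeAddMonoidHom_of]
        by_cases h : i = k
        · subst h
          rw [hs _ _ x.2, DirectSum.of_eq_same]
        · rw [hn _ _ h _ x.2, DirectSum.of_eq_of_ne _ _ _ (Ne.symm h)]
          rfl
      | add a b ha hb => simp [ha, hb]
    intro v w h
    ext k
    rw [← key, ← key, h]
  · intro x
    obtain ⟨S, hS⟩ := hf x
    refine ⟨∑ k ∈ S, DirectSum.of (fun i => gr i) k ⟨P k x, hm k x⟩, ?_⟩
    rw [map_sum]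
    simpa [DirectSum.coeAddMonoidHom_of] using hS

/-! ### Commutative dg algebras and dg modules -/

/-- A unital (graded) commutative dg algebra over `ℝ`, unbounded, with differential of degree
`1`. -/
structure CDGA where
  carrier : Type u
  [ring : Ring carrier]
  [algebra : Algebra ℝ carrier]
  gr : ℤ → Submodule ℝ carrier
  [gradedAlgebra : GradedAlgebra gr]
  mul_comm' : ∀ i j, ∀ a ∈ gr i, ∀ b ∈ gr j, a * b = (-1 : ℝ) ^ (i * j) • (b * a)
  d : carrier →ₗ[ℝ] carrier
  d_mem : ∀ i, ∀ a ∈ gr i, d a ∈ gr (i + 1)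
  d_d : ∀ a, d (d a) = 0
  d_mul : ∀ i, ∀ a ∈ gr i, ∀ b, d (a * b) = d a * b + (-1 : ℝ) ^ i • (a * d b)

namespace CDGA

instance : CoeSort CDGA.{u} (Type u) := ⟨CDGA.carrier⟩

attribute [instance] CDGA.ring CDGA.algebra CDGA.gradedAlgebra

/-- The degree `k` part of the complex `T_A` of derivations of `A`: the linear endomorphisms `D`
of degree `k` with `D (a b) = D (a) b + (-1) ^ (k |a|) a D (b)`. The complex `T_A` is the direct
sum of these submodules of `Module.End ℝ A`; its differential and bracket are the graded
commutators with `d` and of derivations, and `A` acts by multiplication of values. -/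
def der (A : CDGA.{u}) (k : ℤ) : Submodule ℝ (Module.End ℝ A) where
  carrier := {D | (∀ i, ∀ a ∈ A.gr i, D a ∈ A.gr (i + k)) ∧
    ∀ i, ∀ a ∈ A.gr i, ∀ b, D (a * b) = D a * b + (-1 : ℝ) ^ (k * i) • (a * D b)}
  zero_mem' := by simp
  add_mem' := by
    rintro D E ⟨h1, h2⟩ ⟨h3, h4⟩
    refine ⟨fun i a ha => add_mem (h1 i a ha) (h3 i a ha), fun i a ha b => ?_⟩
    simp only [LinearMap.add_apply, h2 i a ha b, h4 i a ha b, add_mul, mul_add, smul_add]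
    abel
  smul_mem' := by
    rintro c D ⟨h1, h2⟩
    refine ⟨fun i a ha => Submodule.smul_mem _ _ (h1 i a ha), fun i a ha b => ?_⟩
    simp only [LinearMap.smul_apply, h2 i a ha b, smul_add, smul_mul_assoc, mul_smul_comm]
    rw [smul_comm]

end CDGA

/-- An (unbounded, left) dg module over the cdga `A`. -/
structure DGModule (A : CDGA.{u}) where
  carrier : Type u
  [addCommGroup : AddCommGroup carrier]
  [moduleReal : Module ℝ carrier]
  [module : Module A.carrier carrier]
  [isScalarTower : IsScalarTower ℝ A.carrier carrier]
  gr : ℤ → Submodule ℝ carrier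
  [decomposition : DirectSum.Decomposition gr]
  smul_mem : ∀ i j, ∀ a ∈ A.gr i, ∀ x ∈ gr j, a • x ∈ gr (i + j)
  d : carrier →ₗ[ℝ] carrier
  d_mem : ∀ k, ∀ x ∈ gr k, d x ∈ gr (k + 1)
  d_d : ∀ x, d (d x) = 0
  d_smul : ∀ i, ∀ a ∈ A.gr i, ∀ x, d (a • x) = A.d a • x + (-1 : ℝ) ^ i • (a • d x)

namespace DGModule

variable {A : CDGA.{u}}

instance : CoeSort (DGModule A) (Type u) := ⟨DGModule.carrier⟩

attribute [instance] DGModule.addCommGroup DGModule.moduleReal DGModule.module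
  DGModule.isScalarTower DGModule.decomposition

instance (M : DGModule A) : SMulCommClass ℝ A.carrier M.carrier :=
  IsScalarTower.to_smulCommClass

/-- The cochain complex of real vector spaces underlying a dg module. -/
noncomputable def complex (M : DGModule A) : CochainComplex (ModuleCat.{u} ℝ) ℤ :=
  CochainComplex.of (fun k => ModuleCat.of ℝ (M.gr k))
    (fun k => ModuleCat.ofHom (M.d.restrict (M.d_mem k)))
    (fun k => by
      ext x
      simp [M.d_d])

end DGModule

/-! ### `L∞`-algebroids -/

/-- The antisymmetric Koszul sign of a permutation of homogeneous elements `x₀, …, x₍ₙ₋₁₎` of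
degrees `deg`: rearranging them as `x_(σ 0), …, x_(σ (n-1))` costs a factor
`-(-1) ^ (|x||y|)` for every two elements `x`, `y` whose order is exchanged. -/
noncomputable def koszulSign {n : ℕ} (deg : Fin n → ℤ) (σ : Equiv.Perm (Fin n)) : ℝ :=
  ∏ p : Fin n, ∏ q : Fin n,
    if p < q ∧ σ q < σ p then -(-1 : ℝ) ^ (deg (σ p) * deg (σ q)) else 1

/-- The `(i, n - i)`-shuffles: permutations which are increasing on the first `i` and on the
last `n - i` positions. -/
def IsShuffle {n : ℕ} (i : ℕ) (σ : Equiv.Perm (Fin n)) : Prop :=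
  ∀ p q : Fin n, p < q → (q.1 < i ∨ i ≤ p.1) → σ p < σ q

instance {n : ℕ} (i : ℕ) (σ : Equiv.Perm (Fin n)) : Decidable (IsShuffle i σ) := by
  unfold IsShuffle; infer_instance

/-- An `L∞`-algebroid over the cdga `A`. The multilinear map `br k` is the bracket with `k + 1`
arguments, of degree `2 - (k + 1)`; `br 0` is the differential and `br 1` the binary bracket. The
anchor `ρ` is a map to `T_A`, regarded as a map to `End_ℝ A` which sends elements of degree `k` to
derivations of degree `k`. -/
structure LInfAlgebroid (A : CDGA.{u}) extends DGModule A where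
  br : ∀ k : ℕ, MultilinearMap ℝ (fun _ : Fin (k + 1) => carrier) carrier
  br_zero : ∀ x, br 0 x = d (x 0)
  br_mem : ∀ (k : ℕ) (deg : Fin (k + 1) → ℤ) (x : Fin (k + 1) → carrier),
    (∀ p, x p ∈ gr (deg p)) → br k x ∈ gr (∑ p, deg p + (1 - k))
  br_perm : ∀ (k : ℕ) (deg : Fin (k + 1) → ℤ) (x : Fin (k + 1) → carrier),
    (∀ p, x p ∈ gr (deg p)) → ∀ σ : Equiv.Perm (Fin (k + 1)),
      br k (fun p => x (σ p)) = koszulSign deg σ • br k x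
  /-- The homotopy Jacobi identities
  `∑_{i + j = n + 1} ∑_σ (-1) ^ (i (j - 1)) χ(σ) [[x_(σ 1), …, x_(σ i)], x_(σ (i + 1)), …] = 0`
  where `σ` runs over the `(i, n - i)`-shuffles; here with `n + 1` and `i + 1` for `n` and `i`. -/
  jacobi : ∀ (n : ℕ) (deg : Fin (n + 1) → ℤ) (x : Fin (n + 1) → carrier),
    (∀ p, x p ∈ gr (deg p)) →
      ∑ i : Fin (n + 1), ∑ σ : Equiv.Perm (Fin (n + 1)) with IsShuffle (i + 1) σ,
        ((-1 : ℝ) ^ ((i + 1) * (n - i) : ℕ) * koszulSign deg σ) •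
          br (n - i) (Fin.cons (br i fun p : Fin (i + 1) => x (σ ⟨p, by omega⟩))
            fun q : Fin (n - i) => x (σ ⟨i + 1 + q, by omega⟩)) = 0
  anchor : carrier →ₗ[ℝ] Module.End ℝ A
  anchor_mem : ∀ k, ∀ x ∈ gr k, anchor x ∈ A.der k
  anchor_smul : ∀ (a : A) (x : carrier), anchor (a • x) = LinearMap.mulLeft ℝ a ∘ₗ anchor x
  anchor_d : ∀ k, ∀ x ∈ gr k,
    anchor (d x) = A.d ∘ₗ anchor x - (-1 : ℝ) ^ k • (anchor x ∘ₗ A.d)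
  anchor_br_one : ∀ i j, ∀ x ∈ gr i, ∀ y ∈ gr j,
    anchor (br 1 ![x, y]) =
      anchor x ∘ₗ anchor y - (-1 : ℝ) ^ (i * j) • (anchor y ∘ₗ anchor x)
  anchor_br : ∀ (k : ℕ), 2 ≤ k → ∀ x, anchor (br k x) = 0
  br_one_smul : ∀ i j k, ∀ a ∈ A.gr i, ∀ x ∈ gr j, ∀ y ∈ gr k,
    br 1 ![x, a • y] = (-1 : ℝ) ^ (i * j) • (a • br 1 ![x, y]) + anchor x a • y
  /-- The higher brackets are `A`-linear in the last argument, with the Koszul sign of moving `a`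
  past the bracket of degree `2 - n`, `n = k + 3`, and past the first `n - 1` arguments. -/
  br_smul : ∀ (k : ℕ) (i : ℤ) (deg : Fin (k + 2) → ℤ), ∀ a ∈ A.gr i,
    ∀ x : Fin (k + 2) → carrier, (∀ p, x p ∈ gr (deg p)) → ∀ y,
      br (k + 2) (Fin.snoc (α := fun _ => carrier) x (a • y)) =
        (-1 : ℝ) ^ (i * (k + 3 + ∑ p, deg p)) •
          (a • br (k + 2) (Fin.snoc (α := fun _ => carrier) x y))

namespace LInfAlgebroid

variable {A : CDGA.{u}}

instance : CoeSort (LInfAlgebroid A) (Type u) := ⟨fun g => g.carrier⟩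

/-- A strict map of `L∞`-algebroids over `A`. -/
@[ext]
structure Hom (g h : LInfAlgebroid A) where
  toLinearMap : g.carrier →ₗ[A.carrier] h.carrier
  map_mem : ∀ k, ∀ x ∈ g.gr k, toLinearMap x ∈ h.gr k
  map_br : ∀ k x, toLinearMap (g.br k x) = h.br k fun p => toLinearMap (x p)
  map_anchor : ∀ x, h.anchor (toLinearMap x) = g.anchor x

/-- The category of `L∞`-algebroids over `A` and strict maps. -/
instance : Category (LInfAlgebroid A) where
  Hom := Hom
  id g := ⟨LinearMap.id, fun _ _ h => h, fun _ _ => rfl, fun _ => rfl⟩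
  comp f f' := ⟨f'.toLinearMap ∘ₗ f.toLinearMap,
    fun k x hx => f'.map_mem k _ (f.map_mem k x hx),
    fun k x => by simp [f.map_br, f'.map_br],
    fun x => by simp [f.map_anchor, f'.map_anchor]⟩

theorem Hom.map_d {g h : LInfAlgebroid A} (f : Hom g h) (x : g) :
    f.toLinearMap (g.d x) = h.d (f.toLinearMap x) := by
  have := f.map_br 0 (fun _ => x)
  rwa [g.br_zero, h.br_zero] at this

/-- The map of complexes underlying a strict map of `L∞`-algebroids. -/
noncomputable def Hom.complexMap {g h : LInfAlgebroid A} (f : Hom g h) :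
    g.toDGModule.complex ⟶ h.toDGModule.complex :=
  CochainComplex.ofHom
    (fun k => ModuleCat.ofHom ((f.toLinearMap.restrictScalars ℝ).restrict (f.map_mem k)))
    (fun k => by
      simp only [DGModule.complex, CochainComplex.of_d]
      ext x
      simp only [ModuleCat.hom_comp, LinearMap.comp_apply, ModuleCat.hom_ofHom]
      exact (f.map_d x.1).symm)

/-- The weak equivalences of the semi-model structure: the quasi-isomorphisms. -/
instance : CategoryWithWeakEquivalences (LInfAlgebroid A) where
  weakEquivalences _ _ f := QuasiIso (Hom.complexMap f)

/-- The fibrations of the semi-model structure: the degreewise surjective maps. -/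
instance : CategoryWithFibrations (LInfAlgebroid A) where
  fibrations g h f := ∀ k, ∀ y ∈ h.gr k, ∃ x ∈ g.gr k, Hom.toLinearMap f x = y

/-- The cofibrations of the semi-model structure: the maps with the left lifting property
against the degreewise surjective quasi-isomorphisms. -/
instance : CategoryWithCofibrations (LInfAlgebroid A) where
  cofibrations :=
    (fibrations (LInfAlgebroid A) ⊓ weakEquivalences (LInfAlgebroid A)).llp

end LInfAlgebroid

/-! ### dg Lie algebroids -/

theorem neg_one_zpow_cases (p : ℤ) : (-1 : ℝ) ^ p = 1 ∨ (-1 : ℝ) ^ p = -1 := by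
  rcases Int.even_or_odd p with h | h
  · exact Or.inl h.neg_one_zpow
  · exact Or.inr h.neg_one_zpow

/-- A dg Lie algebroid over the cdga `A`. -/
structure DGLieAlgebroid (A : CDGA.{u}) extends DGModule A where
  lie : carrier →ₗ[ℝ] carrier →ₗ[ℝ] carrier
  lie_mem : ∀ i j, ∀ x ∈ gr i, ∀ y ∈ gr j, lie x y ∈ gr (i + j)
  lie_antisymm : ∀ i j, ∀ x ∈ gr i, ∀ y ∈ gr j, lie x y = -((-1 : ℝ) ^ (i * j) • lie y x)
  d_lie : ∀ i j, ∀ x ∈ gr i, ∀ y ∈ gr j, d (lie x y) = lie (d x) y + (-1 : ℝ) ^ i • lie x (d y)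
  lie_lie : ∀ i j k, ∀ x ∈ gr i, ∀ y ∈ gr j, ∀ z ∈ gr k,
    lie x (lie y z) = lie (lie x y) z + (-1 : ℝ) ^ (i * j) • lie y (lie x z)
  anchor : carrier →ₗ[ℝ] Module.End ℝ A
  anchor_mem : ∀ k, ∀ x ∈ gr k, anchor x ∈ A.der k
  anchor_smul : ∀ (a : A) (x : carrier), anchor (a • x) = LinearMap.mulLeft ℝ a ∘ₗ anchor x
  anchor_d : ∀ k, ∀ x ∈ gr k,
    anchor (d x) = A.d ∘ₗ anchor x - (-1 : ℝ) ^ k • (anchor x ∘ₗ A.d)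
  anchor_lie : ∀ i j, ∀ x ∈ gr i, ∀ y ∈ gr j,
    anchor (lie x y) = anchor x ∘ₗ anchor y - (-1 : ℝ) ^ (i * j) • (anchor y ∘ₗ anchor x)
  lie_smul : ∀ i j k, ∀ a ∈ A.gr i, ∀ x ∈ gr j, ∀ y ∈ gr k,
    lie x (a • y) = (-1 : ℝ) ^ (i * j) • (a • lie x y) + anchor x a • y

namespace DGLieAlgebroid

variable {A : CDGA.{u}}

instance : CoeSort (DGLieAlgebroid A) (Type u) := ⟨fun g => g.carrier⟩

/-- The brackets of a dg Lie algebroid as an `L∞`-algebroid: the differential, the Lie bracket,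
and zero in all higher arities. -/
noncomputable def br (g : DGLieAlgebroid A) :
    ∀ k : ℕ, MultilinearMap ℝ (fun _ : Fin (k + 1) => g.carrier) g.carrier
  | 0 => MultilinearMap.mk' (fun x => g.d (x 0))
      (fun x i a b => by fin_cases i; simp) (fun x i c a => by fin_cases i; simp)
  | 1 => MultilinearMap.mk' (fun x => g.lie (x 0) (x 1))
      (fun x i a b => by fin_cases i <;> simp) (fun x i c a => by fin_cases i <;> simp)
  | _ + 2 => 0

theorem br_two (g : DGLieAlgebroid A) {k : ℕ} (hk : 2 ≤ k) : g.br k = 0 := by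
  obtain ⟨k, rfl⟩ := Nat.exists_eq_add_of_le' hk
  rfl

theorem br_one_eq (g : DGLieAlgebroid A) (x : Fin 2 → g.carrier) :
    g.br 1 x = g.lie (x 0) (x 1) := rfl

theorem br_zero_eq (g : DGLieAlgebroid A) (x : Fin 1 → g.carrier) : g.br 0 x = g.d (x 0) := rfl

theorem shuffles_one : (Finset.univ.filter fun σ : Equiv.Perm (Fin 1) => IsShuffle 1 σ) =
    {Equiv.refl _} := by decide

theorem shuffles_two_one : (Finset.univ.filter fun σ : Equiv.Perm (Fin 2) => IsShuffle 1 σ) =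
    {Equiv.refl _, Equiv.swap 0 1} := by decide

theorem shuffles_two_two : (Finset.univ.filter fun σ : Equiv.Perm (Fin 2) => IsShuffle 2 σ) =
    {Equiv.refl _} := by decide

theorem shuffles_three_two : (Finset.univ.filter fun σ : Equiv.Perm (Fin 3) => IsShuffle 2 σ) =
    {Equiv.refl _, Equiv.swap 1 2, finRotate 3} := by decide

theorem br_jacobi (g : DGLieAlgebroid A) (n : ℕ) (deg : Fin (n + 1) → ℤ)
    (x : Fin (n + 1) → g.carrier) (hx : ∀ p, x p ∈ g.gr (deg p)) :
      ∑ i : Fin (n + 1), ∑ σ : Equiv.Perm (Fin (n + 1)) with IsShuffle (i + 1) σ,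
        ((-1 : ℝ) ^ ((i + 1) * (n - i) : ℕ) * koszulSign deg σ) •
          g.br (n - i) (Fin.cons (g.br i fun p : Fin (i + 1) => x (σ ⟨p, by omega⟩))
            fun q : Fin (n - i) => x (σ ⟨i + 1 + q, by omega⟩)) = 0 := by
  match n with
  | 0 =>
    rw [Fin.sum_univ_one]
    simp [br_zero_eq, g.d_d]
  | 1 =>
    rw [Fin.sum_univ_two]
    simp only [Fin.val_zero, Fin.val_one, zero_add, Nat.reduceAdd]
    rw [shuffles_two_one, shuffles_two_two, Finset.sum_pair (by decide), Finset.sum_singleton]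
    simp [br_zero_eq, br_one_eq, koszulSign, Fin.prod_univ_two]
    have h1 := g.d_lie _ _ _ (hx 0) _ (hx 1)
    have h2 := g.lie_antisymm _ _ _ (g.d_mem _ _ (hx 1)) _ (hx 0)
    have e : deg 1 * deg 0 = deg 0 * deg 1 := mul_comm _ _
    rw [h1, h2, e, add_mul, one_mul, zpow_add₀ (by norm_num), mul_comm (deg 1)]
    rcases neg_one_zpow_cases (deg 0 * deg 1) with h | h <;> rw [h] <;> module
  | 2 =>
    rw [Fin.sum_univ_three]
    simp only [Fin.val_zero, Fin.val_one, Fin.val_two, zero_add, Nat.reduceAdd]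
    rw [shuffles_three_two, g.br_two (k := 2) le_rfl, Finset.sum_insert (by decide),
      Finset.sum_pair (by decide)]
    have hs : (Equiv.swap 1 2) (0 : Fin 3) = 0 := by decide
    simp [br_zero_eq, br_one_eq, koszulSign, Fin.prod_univ_three, hs]
    have h1 := g.lie_lie _ _ _ _ (hx 0) _ (hx 1) _ (hx 2)
    have h2 := g.lie_antisymm _ _ _ (g.lie_mem _ _ _ (hx 1) _ (hx 2)) _ (hx 0)
    have h3 := g.lie_antisymm _ _ _ (g.lie_mem _ _ _ (hx 0) _ (hx 2)) _ (hx 1)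
    rw [h2, h3, h1, add_mul, add_mul, zpow_add₀ (by norm_num), zpow_add₀ (by norm_num),
      mul_comm (deg 1) (deg 0)]
    rcases neg_one_zpow_cases (deg 0 * deg 1) with h | h <;>
    rcases neg_one_zpow_cases (deg 2 * deg 1) with h' | h' <;>
    rcases neg_one_zpow_cases (deg 2 * deg 0) with h'' | h'' <;> rw [h, h', h''] <;> module
  | n + 3 =>
    refine Finset.sum_eq_zero fun i _ => Finset.sum_eq_zero fun σ _ => ?_
    by_cases hi : 2 ≤ (i : ℕ)
    · have h0 : (Fin.cons (g.br i fun p : Fin (i + 1) => x (σ ⟨p, by omega⟩))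
          (fun q : Fin (n + 3 - i) => x (σ ⟨i + 1 + q, by omega⟩)) :
            Fin (n + 3 - i + 1) → g.carrier) 0 = 0 := by
        rw [Fin.cons_zero, g.br_two hi]; rfl
      rw [MultilinearMap.map_coord_zero _ 0 h0, smul_zero]
    · rw [g.br_two (k := n + 3 - i) (by omega)]
      simp

theorem perm_two (σ : Equiv.Perm (Fin 2)) : σ = Equiv.refl _ ∨ σ = Equiv.swap 0 1 := by
  revert σ; decide

theorem perm_one (σ : Equiv.Perm (Fin 1)) : σ = Equiv.refl _ := Subsingleton.elim _ _

/-- A dg Lie algebroid is an `L∞`-algebroid whose brackets of arity at least `3` vanish. -/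
noncomputable def toLInf (g : DGLieAlgebroid A) : LInfAlgebroid A where
  toDGModule := g.toDGModule
  br := g.br
  br_zero _ := rfl
  br_mem k deg x hx := by
    match k with
    | 0 =>
      rw [br_zero_eq]
      simpa using g.d_mem _ _ (hx 0)
    | 1 =>
      rw [br_one_eq]
      simpa using g.lie_mem _ _ _ (hx 0) _ (hx 1)
    | k + 2 => exact zero_mem _
  br_perm k deg x hx σ := by
    match k with
    | 0 =>
      obtain rfl := perm_one σ
      simp [koszulSign]
    | 1 =>
      rcases perm_two σ with rfl | rfl
      · simp [koszulSign, Fin.prod_univ_two]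
      · rw [br_one_eq, br_one_eq]
        simpa [koszulSign, Fin.prod_univ_two] using g.lie_antisymm _ _ _ (hx 1) _ (hx 0)
    | k + 2 => simp [g.br_two]
  jacobi n deg x hx := g.br_jacobi n deg x hx
  anchor := g.anchor
  anchor_mem := g.anchor_mem
  anchor_smul := g.anchor_smul
  anchor_d := g.anchor_d
  anchor_br_one i j x hx y hy := g.anchor_lie i j x hx y hy
  anchor_br k hk x := by rw [g.br_two hk]; simp
  br_one_smul i j k a ha x hx y hy := g.lie_smul i j k a ha x hx y hy
  br_smul k i deg a _ x _ y := by rw [g.br_two (Nat.le_add_left 2 k)]; simp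

/-- The anchor `g → T_A` is a fibration, that is, degreewise surjective. -/
def IsFibrant (g : DGLieAlgebroid A) : Prop :=
  ∀ k, ∀ D ∈ A.der k, ∃ x ∈ g.gr k, g.anchor x = D

/-- The kernel of the anchor is abelian: its Lie bracket vanishes. -/
def HasAbelianKernel (g : DGLieAlgebroid A) : Prop :=
  ∀ x y, g.anchor x = 0 → g.anchor y = 0 → g.lie x y = 0

end DGLieAlgebroid

/-! ### The simplicial dg Lie algebroid `Hom_{T_A}(C_*(Δ; ℝ), g)`

The normalised chain complex `C_*(Δⁿ; ℝ)` has in degree `-l` the basis of all injective monotone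
maps `[l] → [n]`. Such a map is determined by its image, so the basis is indexed by the nonempty
subsets `s` of `{0, …, n}`, with `l = |s| - 1` the weight of `s`; the `r`-th face of `s` is obtained
by erasing the element of `s` at position `r`. An element of `Hom_ℝ(C_*(Δⁿ; ℝ), g)` is therefore a
function `f` on such subsets with values in `g`, which we extend by `f ∅ = 0`; it is of degree `k`
if `f s` is of degree `k - l` for all `s`. The pair `(x, φ)` is the function with value `x` at the
image of `φ` and zero elsewhere. -/

namespace DGLieAlgebroid

variable {A : CDGA.{u}} (g : DGLieAlgebroid A)

theorem anchor_sign_congr {x y : g} (h : g.anchor x = g.anchor y) :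
    g.anchor (gradedSign g.gr x) = g.anchor (gradedSign g.gr y) := by
  have key : ∀ x : g, g.anchor (gradedSign g.gr x) =
      gradedSign A.gr ∘ₗ g.anchor x ∘ₗ gradedSign A.gr := by
    intro x
    refine graded_induction (gr := g.gr) (by simp) (fun x y hx hy => ?_) (fun k x hx => ?_) x
    · rw [map_add, map_add, hx, hy, map_add, LinearMap.add_comp, LinearMap.comp_add]
    · ext a
      refine graded_induction (gr := A.gr) (by simp) (fun a b ha hb => ?_) (fun i a ha => ?_) a
      · rw [map_add, ha, hb, map_add]
      · rw [gradedSign_of_mem hx, LinearMap.comp_apply, LinearMap.comp_apply,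
          gradedSign_of_mem ha, map_smul, map_smul, map_smul,
          gradedSign_of_mem ((g.anchor_mem k x hx).1 i a ha), LinearMap.smul_apply, smul_smul,
          zpow_add₀ (by norm_num)]
        rcases neg_one_zpow_cases i with h | h <;> rw [h] <;> simp
  rw [key, key, h]

theorem anchor_proj_congr {x y : g} (h : g.anchor x = g.anchor y) (k : ℤ) :
    g.anchor (gradedProj g.gr k x) = g.anchor (gradedProj g.gr k y) := by
  have key : ∀ (x : g) (i : ℤ), ∀ a ∈ A.gr i, g.anchor (gradedProj g.gr k x) a =
      gradedProj A.gr (i + k) (g.anchor x a) := by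
    intro x i a ha
    refine graded_induction (gr := g.gr) (by simp) (fun x y hx hy => ?_) (fun j x hx => ?_) x
    · rw [map_add, map_add, LinearMap.add_apply, hx, hy, map_add, LinearMap.add_apply, map_add]
    · have hm := (g.anchor_mem j x hx).1 i a ha
      by_cases hj : j = k
      · subst hj
        rw [gradedProj_same hx, gradedProj_same hm]
      · rw [gradedProj_ne hx hj, gradedProj_ne hm (by omega)]
        simp
  ext a
  refine graded_induction (gr := A.gr) (by simp) (fun a b ha hb => ?_) (fun i a ha => ?_) a
  · rw [map_add, ha, hb, map_add]
  · rw [key x i a ha, key y i a ha, h]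

theorem anchor_d_congr {x y : g} (h : g.anchor x = g.anchor y) :
    g.anchor (g.d x) = g.anchor (g.d y) := by
  have key : ∀ x : g, g.anchor (g.d x) =
      A.d ∘ₗ g.anchor x - g.anchor (gradedSign g.gr x) ∘ₗ A.d := by
    intro x
    refine graded_induction (gr := g.gr) (by simp) (fun x y hx hy => ?_) (fun k x hx => ?_) x
    · rw [map_add, map_add, hx, hy, map_add, map_add, map_add, LinearMap.comp_add,
        LinearMap.add_comp]
      abel
    · rw [g.anchor_d k x hx, gradedSign_of_mem hx, map_smul, LinearMap.smul_comp]
  rw [key, key, h, g.anchor_sign_congr h]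

/-- The graded `A`-module `Hom_{T_A}(C_*(Δⁿ; ℝ), g)`: the functions `f` as above for which `f s`
lies in the kernel of the anchor if `s` has positive weight, and the `f {i}` all have the same
anchor. -/
def hatCarrier (n : ℕ) : Submodule A.carrier (Finset (Fin (n + 1)) → g.carrier) where
  carrier := {f | f ∅ = 0 ∧ (∀ s, 1 < s.card → g.anchor (f s) = 0) ∧
    ∀ i j, g.anchor (f {i}) = g.anchor (f {j})}
  zero_mem' := by simp
  add_mem' := by
    rintro f h ⟨h1, h2, h3⟩ ⟨h4, h5, h6⟩
    refine ⟨by simp [h1, h4], fun s hs => by simp [h2 s hs, h5 s hs], fun i j => ?_⟩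
    simp [h3 i j, h6 i j]
  smul_mem' := by
    rintro a f ⟨h1, h2, h3⟩
    refine ⟨by simp [h1], fun s hs => ?_, fun i j => ?_⟩
    · rw [Pi.smul_apply, g.anchor_smul, h2 s hs, LinearMap.comp_zero]
    rw [Pi.smul_apply, Pi.smul_apply, g.anchor_smul, g.anchor_smul, h3 i j]

/-- The homogeneous elements of degree `k`: the value at `s`, of weight `l = |s| - 1`, has degree
`k - l`. -/
def hatGr (n : ℕ) (k : ℤ) : Submodule ℝ (g.hatCarrier n) where
  carrier := {f | ∀ s, f.1 s ∈ g.gr (k - (s.card - 1))}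
  zero_mem' := fun s => zero_mem _
  add_mem' := fun {f h} hf hh s => by
    have e : (f + h).1 s = f.1 s + h.1 s := rfl
    rw [e]
    exact Submodule.add_mem _ (hf s) (hh s)
  smul_mem' := fun c f h s => by
    have e : (c • f).1 s = c • f.1 s := rfl
    rw [e]
    exact Submodule.smul_mem _ c (h s)

/-- The position of `r` in `s`. -/
def facePos {n : ℕ} (s : Finset (Fin (n + 1))) (r : Fin (n + 1)) : ℕ := (s.filter (· < r)).card

/-- The differential `f ↦ d ∘ f - (-1) ^ |f| f ∘ ∂` of the hom complex. At a face `s` of weight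
`|s| - 1` the value `f (s.erase r)` has degree `|f| - |s| + 2`, so that `(-1) ^ |f|` is the sign
`(-1) ^ |s|` times that of the degree of `f (s.erase r)`. -/
noncomputable def hatDFun (n : ℕ) (f : Finset (Fin (n + 1)) → g.carrier) :
    Finset (Fin (n + 1)) → g.carrier := fun s =>
  g.d (f s) - (-1 : ℝ) ^ s.card •
    ∑ r ∈ s, (-1 : ℝ) ^ facePos s r • gradedSign g.gr (f (s.erase r))

/-- The bracket. At a vertex it is the bracket of the values; at a face `s` of positive weight
`l = |s| - 1` it is the average over the vertices `i` of `s` of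
`[f i, h s] + (-1) ^ (l |h|) [f s, h i]`; the sign is the one which makes the bracket graded antisymmetric. -/
noncomputable def hatLieFun (n : ℕ) (f h : Finset (Fin (n + 1)) → g.carrier) :
    Finset (Fin (n + 1)) → g.carrier := fun s =>
  if s.card ≤ 1 then g.lie (f s) (h s)
  else (s.card : ℝ)⁻¹ • ∑ i ∈ s,
    (g.lie (f {i}) (h s) + g.lie (f s) ((gradedSign g.gr ^ (s.card - 1)) (h {i})))

variable {g} {n : ℕ}

theorem hatDFun_mem {f : Finset (Fin (n + 1)) → g.carrier} (hf : f ∈ g.hatCarrier n) :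
    g.hatDFun n f ∈ g.hatCarrier n := by
  obtain ⟨h1, h2, h3⟩ := hf
  refine ⟨by simp [hatDFun, h1], fun s hs => ?_, fun i j => ?_⟩
  · have hd : g.anchor (g.d (f s)) = 0 := by
      rw [g.anchor_d_congr (y := 0) (by rw [h2 s hs, map_zero]), map_zero, map_zero]
    rw [hatDFun, map_sub, hd, map_smul, map_sum, zero_sub, neg_eq_zero]
    simp only [map_smul (g.anchor)]
    rcases Nat.lt_or_ge 2 s.card with h | h
    · rw [Finset.sum_eq_zero, smul_zero]
      intro r hr
      rw [g.anchor_sign_congr (y := 0), map_zero, map_zero, smul_zero]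
      rw [h2, map_zero]
      rw [Finset.card_erase_of_mem hr]
      omega
    · obtain ⟨i, j, hij, rfl⟩ := Finset.card_eq_two.1 (le_antisymm h hs)
      wlog hlt : i < j generalizing i j
      · rw [Finset.pair_comm]
        exact this j i hij.symm (by rwa [Finset.pair_comm]) (by rwa [Finset.pair_comm])
          (by rwa [Finset.pair_comm]) (lt_of_le_of_ne (not_lt.1 hlt) hij.symm)
      have e1 : ({i, j} : Finset (Fin (n + 1))).erase i = {j} := by
        rw [Finset.erase_insert (by simpa using hij)]
      have e2 : ({i, j} : Finset (Fin (n + 1))).erase j = {i} := by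
        rw [Finset.pair_comm, Finset.erase_insert (by simpa using hij.symm)]
      have p1 : facePos {i, j} i = 0 := by
        simp [facePos, Finset.filter_insert, Finset.filter_singleton, hlt.le]
      have p2 : facePos {i, j} j = 1 := by
        simp [facePos, Finset.filter_insert, Finset.filter_singleton, hlt]
      rw [Finset.sum_pair hij, e1, e2, p1, p2, g.anchor_sign_congr (h3 i j)]
      simp only [pow_zero, pow_one, one_smul, neg_smul, add_neg_cancel, smul_zero]
  · have key : ∀ i, g.hatDFun n f {i} = g.d (f {i}) := by
      intro i
      simp [hatDFun, h1]
    rw [key, key]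
    exact g.anchor_d_congr (h3 i j)


theorem anchor_lie_eq_zero {x y : g} (h : g.anchor x = 0 ∨ g.anchor y = 0) :
    g.anchor (g.lie x y) = 0 := by
  obtain ⟨S, hS⟩ := finite_gradedProj (gr := g.gr) x
  obtain ⟨T, hT⟩ := finite_gradedProj (gr := g.gr) y
  rw [← hS S subset_rfl, ← hT T subset_rfl]
  simp only [map_sum, LinearMap.sum_apply]
  refine Finset.sum_eq_zero fun i _ => Finset.sum_eq_zero fun j _ => ?_
  rw [g.anchor_lie _ _ _ (gradedProj_mem _ _) _ (gradedProj_mem _ _)]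
  rcases h with h | h
  · rw [g.anchor_proj_congr (y := 0) (h.trans (map_zero _).symm), map_zero, map_zero]
    simp
  · rw [g.anchor_proj_congr (x := y) (y := 0) (h.trans (map_zero _).symm), map_zero, map_zero]
    simp

theorem anchor_lie_congr {x x' y y' : g} (hx : g.anchor x = g.anchor x')
    (hy : g.anchor y = g.anchor y') : g.anchor (g.lie x y) = g.anchor (g.lie x' y') := by
  have e : g.lie x y = g.lie (x - x') y + g.lie x' (y - y') + g.lie x' y' := by
    simp only [map_sub, LinearMap.sub_apply]; abel
  rw [e, map_add, map_add, anchor_lie_eq_zero (Or.inl (by rw [map_sub, hx, sub_self])),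
    anchor_lie_eq_zero (Or.inr (by rw [map_sub, hy, sub_self])), zero_add, zero_add]

theorem anchor_sign_pow_congr (m : ℕ) {x y : g} (h : g.anchor x = g.anchor y) :
    g.anchor ((gradedSign g.gr ^ m) x) = g.anchor ((gradedSign g.gr ^ m) y) := by
  induction m with
  | zero => simpa using h
  | succ m ih =>
    rw [pow_succ', Module.End.mul_apply, Module.End.mul_apply]
    exact g.anchor_sign_congr ih

theorem hatLieFun_mem {f h : Finset (Fin (n + 1)) → g.carrier} (hf : f ∈ g.hatCarrier n)
    (hh : h ∈ g.hatCarrier n) : g.hatLieFun n f h ∈ g.hatCarrier n := by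
  refine ⟨by simp [hatLieFun, hf.1], fun s hs => ?_, fun i j => ?_⟩
  · rw [hatLieFun, if_neg (not_le.2 hs), map_smul, map_sum, Finset.sum_eq_zero, smul_zero]
    intro i _
    rw [map_add, anchor_lie_eq_zero (Or.inr (hh.2.1 s hs)),
      anchor_lie_eq_zero (Or.inl (hf.2.1 s hs)), add_zero]
  · simp only [hatLieFun, Finset.card_singleton, le_refl, if_true]
    exact anchor_lie_congr (hf.2.2 i j) (hh.2.2 i j)

variable (g n)

/-- The differential of `Hom_{T_A}(C_*(Δⁿ; ℝ), g)`. -/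
noncomputable def hatD : g.hatCarrier n →ₗ[ℝ] g.hatCarrier n where
  toFun f := ⟨g.hatDFun n f.1, hatDFun_mem f.2⟩
  map_add' f h := by
    apply Subtype.ext
    funext s
    have e : ∀ t, (f + h).1 t = f.1 t + h.1 t := fun _ => rfl
    change g.hatDFun n (f + h).1 s = g.hatDFun n f.1 s + g.hatDFun n h.1 s
    simp only [hatDFun, e, map_add, smul_add, Finset.sum_add_distrib]
    abel
  map_smul' c f := by
    apply Subtype.ext
    funext s
    have e : ∀ t, (c • f).1 t = c • f.1 t := fun _ => rfl
    change g.hatDFun n (c • f).1 s = c • g.hatDFun n f.1 s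
    simp only [hatDFun, e, map_smul, smul_sub, Finset.smul_sum]
    simp only [smul_comm c]

/-- The bracket of `Hom_{T_A}(C_*(Δⁿ; ℝ), g)`. -/
noncomputable def hatLie : g.hatCarrier n →ₗ[ℝ] g.hatCarrier n →ₗ[ℝ] g.hatCarrier n :=
  LinearMap.mk₂ ℝ (fun f h => ⟨g.hatLieFun n f.1 h.1, hatLieFun_mem f.2 h.2⟩)
    (fun f f' h => by
      apply Subtype.ext
      funext s
      have e : ∀ t, (f + f').1 t = f.1 t + f'.1 t := fun _ => rfl
      change g.hatLieFun n (f + f').1 h.1 s = g.hatLieFun n f.1 h.1 s + g.hatLieFun n f'.1 h.1 s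
      simp only [hatLieFun]
      split_ifs
      · simp only [e, map_add, LinearMap.add_apply]
      · simp only [e, map_add, LinearMap.add_apply, ← smul_add, ← Finset.sum_add_distrib]
        congr 1
        refine Finset.sum_congr rfl fun i _ => ?_
        abel)
    (fun c f h => by
      apply Subtype.ext
      funext s
      have e : ∀ t, (c • f).1 t = c • f.1 t := fun _ => rfl
      change g.hatLieFun n (c • f).1 h.1 s = c • g.hatLieFun n f.1 h.1 s
      simp only [hatLieFun]
      split_ifs
      · simp only [e, map_smul, LinearMap.smul_apply]
      · simp only [e, map_smul, LinearMap.smul_apply, ← smul_add, ← Finset.smul_sum]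
        rw [smul_comm])
    (fun f h h' => by
      apply Subtype.ext
      funext s
      have e : ∀ t, (h + h').1 t = h.1 t + h'.1 t := fun _ => rfl
      change g.hatLieFun n f.1 (h + h').1 s = g.hatLieFun n f.1 h.1 s + g.hatLieFun n f.1 h'.1 s
      simp only [hatLieFun]
      split_ifs
      · simp only [e, map_add]
      · simp only [e, map_add, ← smul_add, ← Finset.sum_add_distrib]
        congr 1
        refine Finset.sum_congr rfl fun i _ => ?_
        abel)
    (fun c f h => by
      apply Subtype.ext
      funext s
      have e : ∀ t, (c • h).1 t = c • h.1 t := fun _ => rfl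
      change g.hatLieFun n f.1 (c • h).1 s = c • g.hatLieFun n f.1 h.1 s
      simp only [hatLieFun]
      split_ifs
      · simp only [e, map_smul]
      · simp only [e, map_smul, ← smul_add, ← Finset.smul_sum]
        rw [smul_comm])

/-- The anchor of `Hom_{T_A}(C_*(Δⁿ; ℝ), g)`: the common anchor of the values at the vertices. -/
noncomputable def hatAnchor : g.hatCarrier n →ₗ[ℝ] Module.End ℝ A where
  toFun f := g.anchor (f.1 {0})
  map_add' _ _ := g.anchor.map_add _ _
  map_smul' _ _ := g.anchor.map_smul _ _

/-- The projections of `Hom_{T_A}(C_*(Δⁿ; ℝ), g)` to its homogeneous parts. -/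
noncomputable def hatProj (k : ℤ) : g.hatCarrier n →ₗ[ℝ] g.hatCarrier n where
  toFun f := ⟨fun s => gradedProj g.gr (k - (s.card - 1)) (f.1 s), by
    refine ⟨by simp [f.2.1], fun s hs => ?_, fun i j => ?_⟩
    · rw [g.anchor_proj_congr (y := 0) (by rw [f.2.2.1 s hs, map_zero]), map_zero, map_zero]
    · simp only [Finset.card_singleton]
      exact g.anchor_proj_congr (f.2.2.2 i j) _⟩
  map_add' _ _ := Subtype.ext (funext fun s => (gradedProj g.gr _).map_add _ _)
  map_smul' _ _ := Subtype.ext (funext fun s => (gradedProj g.gr _).map_smul _ _)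

theorem hat_isInternal : DirectSum.IsInternal (g.hatGr n) := by
  classical
  refine isInternal_of_proj _ (g.hatProj n) (fun k f s => gradedProj_mem _ _) (fun k f hf => ?_)
    (fun k j hkj f hf => ?_) fun f => ?_
  · exact Subtype.ext (funext fun s => gradedProj_same (hf s))
  · exact Subtype.ext (funext fun s => gradedProj_ne (hf s) (by omega))
  · choose S hS using fun s => finite_gradedProj (gr := g.gr) (f.1 s)
    refine ⟨Finset.univ.biUnion fun s : Finset (Fin (n + 1)) =>
      (S s).image (· + ((s.card : ℤ) - 1)), ?_⟩
    apply Subtype.ext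
    funext s
    rw [AddSubmonoidClass.coe_finsetSum, Finset.sum_apply]
    change ∑ k ∈ _, gradedProj g.gr (k - (s.card - 1)) (f.1 s) = f.1 s
    have key := hS s (Finset.image (· - ((s.card : ℤ) - 1)) (Finset.univ.biUnion
      fun s : Finset (Fin (n + 1)) => (S s).image (· + ((s.card : ℤ) - 1)))) (by
        intro k hk
        simp only [Finset.mem_image, Finset.mem_biUnion, Finset.mem_univ, true_and]
        exact ⟨k + (s.card - 1), ⟨s, k, hk, rfl⟩, by ring⟩)
    rwa [Finset.sum_image (by intro a _ b _ h; simpa using h)] at key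

noncomputable instance hatDecomposition : DirectSum.Decomposition (g.hatGr n) :=
  (g.hat_isInternal n).chooseDecomposition

variable {g n}

theorem lie_congr_left {x x' v : g} (h : g.HasAbelianKernel) (hx : g.anchor x = g.anchor x')
    (hv : g.anchor v = 0) : g.lie x v = g.lie x' v := by
  rw [← sub_eq_zero, ← LinearMap.sub_apply, ← map_sub]
  exact h _ _ (by rw [map_sub, hx, sub_self]) hv

theorem lie_congr_right {x x' v : g} (h : g.HasAbelianKernel) (hx : g.anchor x = g.anchor x')
    (hv : g.anchor v = 0) : g.lie v x = g.lie v x' := by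
  rw [← sub_eq_zero, ← map_sub]
  exact h _ _ hv (by rw [map_sub, hx, sub_self])

theorem hatGr_vertex {p : ℤ} {f : g.hatCarrier n} (hf : f ∈ g.hatGr n p) (i : Fin (n + 1)) :
    f.1 {i} ∈ g.gr p := by simpa using hf {i}

theorem hatD_apply {p : ℤ} {f : g.hatCarrier n} (hf : f ∈ g.hatGr n p)
    (s : Finset (Fin (n + 1))) :
    (g.hatD n f).1 s =
      g.d (f.1 s) - (-1 : ℝ) ^ p • ∑ r ∈ s, (-1 : ℝ) ^ facePos s r • f.1 (s.erase r) := by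
  change g.hatDFun n f.1 s = _
  rw [hatDFun, Finset.smul_sum, Finset.smul_sum]
  congr 1
  refine Finset.sum_congr rfl fun r hr => ?_
  have hc : ((s.erase r).card : ℤ) = s.card - 1 := by
    rw [Finset.card_erase_of_mem hr, Nat.cast_sub (Finset.card_pos.2 ⟨r, hr⟩)]; simp
  rw [gradedSign_of_mem (hf (s.erase r)), hc, smul_comm ((-1 : ℝ) ^ p), smul_comm ((-1) ^ s.card),
    smul_smul ((-1 : ℝ) ^ s.card)]
  congr 2
  rw [← zpow_natCast, ← zpow_add₀ (by norm_num)]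
  have : (s.card : ℤ) + (p - ((s.card : ℤ) - 1 - 1)) = p + 2 * 1 := by ring
  rw [this, zpow_add₀ (by norm_num), zpow_mul]
  norm_num

theorem hatD_vertex (f : g.hatCarrier n) (i : Fin (n + 1)) :
    (g.hatD n f).1 {i} = g.d (f.1 {i}) := by
  change g.hatDFun n f.1 {i} = _
  simp [hatDFun, f.2.1]

theorem hatLie_vertex (f h : g.hatCarrier n) (i : Fin (n + 1)) :
    (g.hatLie n f h).1 {i} = g.lie (f.1 {i}) (h.1 {i}) := by
  change g.hatLieFun n f.1 h.1 {i} = _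
  simp [hatLieFun]

theorem hatLie_apply (hab : g.HasAbelianKernel) {q : ℤ} (f : g.hatCarrier n)
    {h : g.hatCarrier n} (hh : h ∈ g.hatGr n q) {s : Finset (Fin (n + 1))} (hs : 1 < s.card)
    (i : Fin (n + 1)) :
    (g.hatLie n f h).1 s =
      g.lie (f.1 {i}) (h.1 s) + (-1 : ℝ) ^ (((s.card : ℤ) - 1) * q) • g.lie (f.1 s) (h.1 {i}) := by
  change g.hatLieFun n f.1 h.1 s = _
  rw [hatLieFun, if_neg (not_le.2 hs)]
  have key : ∀ j ∈ s, g.lie (f.1 {j}) (h.1 s) +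
      g.lie (f.1 s) ((gradedSign g.gr ^ (s.card - 1)) (h.1 {j})) =
      g.lie (f.1 {i}) (h.1 s) +
        (-1 : ℝ) ^ (((s.card : ℤ) - 1) * q) • g.lie (f.1 s) (h.1 {i}) := by
    intro j _
    rw [lie_congr_left hab (f.2.2.2 j i) (h.2.2.1 s hs),
      lie_congr_right hab (anchor_sign_pow_congr _ (h.2.2.2 j i)) (f.2.2.1 s hs),
      gradedSign_pow_of_mem _ (hatGr_vertex hh i), map_smul, Nat.cast_sub hs.le, Nat.cast_one]
  rw [Finset.sum_congr rfl key, Finset.sum_const, ← Nat.cast_smul_eq_nsmul ℝ, smul_smul,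
    inv_mul_cancel₀ (by positivity), one_smul]

theorem facePos_erase_of_lt {s : Finset (Fin (n + 1))} {r q : Fin (n + 1)} (hr : r ∈ s)
    (h : r < q) : facePos (s.erase r) q + 1 = facePos s q := by
  rw [facePos, facePos, Finset.filter_erase, Finset.card_erase_add_one]
  simp [hr, h]

theorem facePos_erase_of_gt {s : Finset (Fin (n + 1))} {r q : Fin (n + 1)}
    (h : q < r) : facePos (s.erase r) q = facePos s q := by
  rw [facePos, facePos, Finset.filter_erase, Finset.erase_eq_of_notMem]
  simp [h.le]

theorem sum_erase_erase (f : Finset (Fin (n + 1)) → g.carrier) (s : Finset (Fin (n + 1))) :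
    ∑ r ∈ s, (-1 : ℝ) ^ facePos s r •
      ∑ q ∈ s.erase r, (-1 : ℝ) ^ facePos (s.erase r) q • f ((s.erase r).erase q) = 0 := by
  simp only [Finset.smul_sum, smul_smul]
  rw [Finset.sum_sigma']
  have hlt : ∀ r ∈ s, ∀ q ∈ s, r < q →
      ((-1 : ℝ) ^ facePos s r * (-1 : ℝ) ^ facePos (s.erase r) q) • f ((s.erase r).erase q) +
      ((-1 : ℝ) ^ facePos s q * (-1 : ℝ) ^ facePos (s.erase q) r) • f ((s.erase q).erase r) =
        0 := by
    intro r hr q hq h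
    rw [facePos_erase_of_gt h, ← facePos_erase_of_lt hr h, Finset.erase_right_comm, pow_succ]
    module
  refine Finset.sum_involution (fun x _ => ⟨x.2, x.1⟩) ?_ ?_ ?_ ?_
  · rintro ⟨r, q⟩ hx
    simp only [Finset.mem_sigma, Finset.mem_erase] at hx
    obtain ⟨hr, hqr, hq⟩ := hx
    rcases lt_or_gt_of_ne hqr with h | h
    · rw [add_comm]; exact hlt q hq r hr h
    · exact hlt r hr q hq h
  · rintro ⟨r, q⟩ hx _
    simp only [Finset.mem_sigma, Finset.mem_erase] at hx
    intro h
    simp only [Sigma.mk.injEq] at h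
    exact hx.2.1 h.1
  · rintro ⟨r, q⟩ hx
    simp only [Finset.mem_sigma, Finset.mem_erase] at hx ⊢
    exact ⟨hx.2.2, hx.2.1.symm, hx.1⟩
  · rintro ⟨r, q⟩ hx
    rfl

theorem hatD_mem {p : ℤ} {f : g.hatCarrier n} (hf : f ∈ g.hatGr n p) :
    g.hatD n f ∈ g.hatGr n (p + 1) := by
  intro s
  rw [hatD_apply hf]
  refine sub_mem ?_ (Submodule.smul_mem _ _ (Submodule.sum_mem _ fun r hr =>
    Submodule.smul_mem _ _ ?_))
  · have := g.d_mem _ _ (hf s)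
    rwa [show p - ((s.card : ℤ) - 1) + 1 = p + 1 - (s.card - 1) by ring] at this
  · have hc : ((s.erase r).card : ℤ) = s.card - 1 := by
      rw [Finset.card_erase_of_mem hr, Nat.cast_sub (Finset.card_pos.2 ⟨r, hr⟩)]; simp
    have := hf (s.erase r)
    rwa [hc, show p - ((s.card : ℤ) - 1 - 1) = p + 1 - (s.card - 1) by ring] at this

theorem hatD_hatD (f : g.hatCarrier n) : g.hatD n (g.hatD n f) = 0 := by
  induction f using graded_induction (gr := g.hatGr n) with
  | h0 => simp
  | hadd x y hx hy => rw [map_add, map_add, hx, hy, add_zero]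
  | hm p f hf =>
    apply Subtype.ext
    funext s
    rw [hatD_apply (hatD_mem hf), hatD_apply hf]
    change _ = (0 : g)
    have e : ∀ r, (g.hatD n f).1 (s.erase r) = g.d (f.1 (s.erase r)) - (-1 : ℝ) ^ p •
        ∑ q ∈ s.erase r, (-1 : ℝ) ^ facePos (s.erase r) q • f.1 ((s.erase r).erase q) :=
      fun r => hatD_apply hf _
    have e2 : ∑ r ∈ s, (-1 : ℝ) ^ facePos s r • (g.hatD n f).1 (s.erase r) =
        ∑ r ∈ s, (-1 : ℝ) ^ facePos s r • g.d (f.1 (s.erase r)) := by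
      simp only [e, smul_sub, Finset.sum_sub_distrib]
      simp only [smul_comm _ ((-1 : ℝ) ^ p), ← Finset.smul_sum]
      rw [sum_erase_erase, smul_zero, sub_zero]
    rw [e2, map_sub, g.d_d, map_smul, map_sum, zpow_add₀ (by norm_num)]
    simp only [map_smul]
    module

theorem hat_ext {f h : g.hatCarrier n} (h1 : ∀ i, f.1 {i} = h.1 {i})
    (h2 : ∀ s, 1 < s.card → f.1 s = h.1 s) : f = h := by
  apply Subtype.ext
  funext s
  rcases Nat.lt_or_ge 1 s.card with hs | hs
  · exact h2 s hs
  · rcases Finset.card_le_one_iff_subset_singleton.1 hs with ⟨i, hi⟩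
    rcases Finset.subset_singleton_iff.1 hi with rfl | rfl
    · rw [f.2.1, h.2.1]
    · exact h1 i

theorem exists_pair {s : Finset (Fin (n + 1))} (hs : s.card = 2) :
    ∃ i j, s = {i, j} ∧ ∀ F : Finset (Fin (n + 1)) → g.carrier,
      ∑ r ∈ s, (-1 : ℝ) ^ facePos s r • F (s.erase r) = F {j} - F {i} := by
  have key : ∀ i j : Fin (n + 1), i < j → ∀ F : Finset (Fin (n + 1)) → g.carrier,
      ∑ r ∈ {i, j}, (-1 : ℝ) ^ facePos {i, j} r • F (Finset.erase {i, j} r) = F {j} - F {i} := by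
    intro i j hlt F
    have e1 : ({i, j} : Finset (Fin (n + 1))).erase i = {j} := by
      rw [Finset.erase_insert (by simpa using hlt.ne)]
    have e2 : ({i, j} : Finset (Fin (n + 1))).erase j = {i} := by
      rw [Finset.pair_comm, Finset.erase_insert (by simpa using hlt.ne')]
    have p1 : facePos {i, j} i = 0 := by
      simp [facePos, Finset.filter_insert, Finset.filter_singleton, hlt.le]
    have p2 : facePos {i, j} j = 1 := by
      simp [facePos, Finset.filter_insert, Finset.filter_singleton, hlt]
    rw [Finset.sum_pair hlt.ne, e1, e2, p1, p2]
    module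
  obtain ⟨i, j, hij, rfl⟩ := Finset.card_eq_two.1 hs
  rcases lt_or_gt_of_ne hij with h | h
  · exact ⟨i, j, rfl, key i j h⟩
  · exact ⟨j, i, Finset.pair_comm i j, by rw [Finset.pair_comm]; exact key j i h⟩

theorem hatLie_mem (hab : g.HasAbelianKernel) {p q : ℤ} {f h : g.hatCarrier n}
    (hf : f ∈ g.hatGr n p) (hh : h ∈ g.hatGr n q) : g.hatLie n f h ∈ g.hatGr n (p + q) := by
  intro s
  rcases Nat.lt_or_ge 1 s.card with hs | hs
  · rw [hatLie_apply hab f hh hs 0]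
    refine add_mem ?_ (Submodule.smul_mem _ _ ?_)
    · have := g.lie_mem _ _ _ (hatGr_vertex hf 0) _ (hh s)
      rwa [← add_sub_assoc] at this
    · have := g.lie_mem _ _ _ (hf s) _ (hatGr_vertex hh 0)
      rwa [show p - ((s.card : ℤ) - 1) + q = p + q - (s.card - 1) by ring] at this
  · rcases Finset.card_le_one_iff_subset_singleton.1 hs with ⟨i, hi⟩
    rcases Finset.subset_singleton_iff.1 hi with rfl | rfl
    · rw [(g.hatLie n f h).2.1]
      exact zero_mem _
    · rw [hatLie_vertex]
      simpa using g.lie_mem _ _ _ (hatGr_vertex hf i) _ (hatGr_vertex hh i)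

theorem hatLie_antisymm (hab : g.HasAbelianKernel) {p q : ℤ} {f h : g.hatCarrier n}
    (hf : f ∈ g.hatGr n p) (hh : h ∈ g.hatGr n q) :
    g.hatLie n f h = -((-1 : ℝ) ^ (p * q) • g.hatLie n h f) := by
  refine hat_ext (fun i => ?_) fun s hs => ?_
  · change _ = -((-1 : ℝ) ^ (p * q) • (g.hatLie n h f).1 {i})
    rw [hatLie_vertex, hatLie_vertex]
    exact g.lie_antisymm _ _ _ (hatGr_vertex hf i) _ (hatGr_vertex hh i)
  · change _ = -((-1 : ℝ) ^ (p * q) • (g.hatLie n h f).1 s)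
    rw [hatLie_apply hab f hh hs 0, hatLie_apply hab h hf hs 0,
      g.lie_antisymm _ _ _ (hatGr_vertex hf 0) _ (hh s),
      g.lie_antisymm _ _ _ (hf s) _ (hatGr_vertex hh 0)]
    generalize (s.card : ℤ) - 1 = l
    rw [mul_sub, sub_mul, sub_eq_add_neg, sub_eq_add_neg, zpow_add₀ (by norm_num),
      zpow_add₀ (by norm_num), zpow_neg, zpow_neg, mul_comm p l]
    rcases neg_one_zpow_cases (p * q) with h1 | h1 <;>
    rcases neg_one_zpow_cases (l * p) with h2 | h2 <;>
    rcases neg_one_zpow_cases (l * q) with h3 | h3 <;> rw [h1, h2, h3] <;> norm_num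

theorem hatLie_lie (hab : g.HasAbelianKernel) {p q r : ℤ} {x y z : g.hatCarrier n}
    (hx : x ∈ g.hatGr n p) (hy : y ∈ g.hatGr n q) (hz : z ∈ g.hatGr n r) :
    g.hatLie n x (g.hatLie n y z) =
      g.hatLie n (g.hatLie n x y) z + (-1 : ℝ) ^ (p * q) • g.hatLie n y (g.hatLie n x z) := by
  refine hat_ext (fun i => ?_) fun s hs => ?_
  · change _ = (g.hatLie n (g.hatLie n x y) z).1 {i} +
      (-1 : ℝ) ^ (p * q) • (g.hatLie n y (g.hatLie n x z)).1 {i}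
    simp only [hatLie_vertex]
    exact g.lie_lie _ _ _ _ (hatGr_vertex hx i) _ (hatGr_vertex hy i) _ (hatGr_vertex hz i)
  · change _ = (g.hatLie n (g.hatLie n x y) z).1 s +
      (-1 : ℝ) ^ (p * q) • (g.hatLie n y (g.hatLie n x z)).1 s
    rw [hatLie_apply hab x (hatLie_mem hab hy hz) hs 0, hatLie_apply hab y hz hs 0,
      hatLie_apply hab (g.hatLie n x y) hz hs 0, hatLie_apply hab x hy hs 0,
      hatLie_apply hab y (hatLie_mem hab hx hz) hs 0, hatLie_apply hab x hz hs 0]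
    simp only [hatLie_vertex, map_add, map_smul, LinearMap.add_apply, LinearMap.smul_apply]
    have e1 := g.lie_lie _ _ _ _ (hatGr_vertex hx 0) _ (hatGr_vertex hy 0) _ (hz s)
    have e2 := g.lie_lie _ _ _ _ (hatGr_vertex hx 0) _ (hy s) _ (hatGr_vertex hz 0)
    have e3 := g.lie_lie _ _ _ _ (hx s) _ (hatGr_vertex hy 0) _ (hatGr_vertex hz 0)
    rw [e1, e2, e3]
    generalize (s.card : ℤ) - 1 = l
    rw [mul_sub, sub_mul, sub_eq_add_neg, sub_eq_add_neg, mul_add, mul_add]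
    simp only [zpow_add₀ (show (-1 : ℝ) ≠ 0 by norm_num), zpow_neg]
    rw [mul_comm p l]
    rcases neg_one_zpow_cases (p * q) with h1 | h1 <;>
    rcases neg_one_zpow_cases (l * p) with h2 | h2 <;>
    rcases neg_one_zpow_cases (l * r) with h4 | h4 <;>
    rcases neg_one_zpow_cases (l * q) with h3 | h3 <;> rw [h1, h2, h3, h4] <;> norm_num <;> abel

theorem hatD_lie (hab : g.HasAbelianKernel) {p q : ℤ} {x y : g.hatCarrier n}
    (hx : x ∈ g.hatGr n p) (hy : y ∈ g.hatGr n q) :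
    g.hatD n (g.hatLie n x y) =
      g.hatLie n (g.hatD n x) y + (-1 : ℝ) ^ p • g.hatLie n x (g.hatD n y) := by
  refine hat_ext (fun i => ?_) fun s hs => ?_
  · change _ = (g.hatLie n (g.hatD n x) y).1 {i} +
      (-1 : ℝ) ^ p • (g.hatLie n x (g.hatD n y)).1 {i}
    simp only [hatLie_vertex, hatD_vertex]
    exact g.d_lie _ _ _ (hatGr_vertex hx i) _ (hatGr_vertex hy i)
  · change _ = (g.hatLie n (g.hatD n x) y).1 s +
      (-1 : ℝ) ^ p • (g.hatLie n x (g.hatD n y)).1 s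
    have e1 := g.d_lie _ _ _ (hatGr_vertex hx 0) _ (hy s)
    have e2 := g.d_lie _ _ _ (hx s) _ (hatGr_vertex hy 0)
    rw [hatD_apply (hatLie_mem hab hx hy), hatLie_apply hab _ hy hs 0,
      hatLie_apply hab _ (hatD_mem hy) hs 0, hatLie_apply hab _ hy hs 0, hatD_vertex, hatD_vertex,
      hatD_apply hx, hatD_apply hy]
    have key : ∑ r ∈ s, (-1 : ℝ) ^ facePos s r • (g.hatLie n x y).1 (s.erase r) =
        g.lie (x.1 {0}) (∑ r ∈ s, (-1 : ℝ) ^ facePos s r • y.1 (s.erase r)) +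
        (-1 : ℝ) ^ (((s.card : ℤ) - 1) * q + q) •
          g.lie (∑ r ∈ s, (-1 : ℝ) ^ facePos s r • x.1 (s.erase r)) (y.1 {0}) := by
      rcases Nat.lt_or_ge 2 s.card with h | h
      · simp only [map_sum, map_smul, LinearMap.sum_apply, LinearMap.smul_apply, Finset.smul_sum,
          ← Finset.sum_add_distrib]
        refine Finset.sum_congr rfl fun r hr => ?_
        have hc : (s.erase r).card = s.card - 1 := Finset.card_erase_of_mem hr
        rw [hatLie_apply hab x hy (by omega) 0, hc, Nat.cast_sub hs.le, Nat.cast_one,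
          show ((s.card : ℤ) - 1) * q + q = ((s.card : ℤ) - 1 - 1) * q + 2 * q by ring,
          zpow_add₀ (by norm_num) _ (2 * q), zpow_mul _ 2]
        norm_num
        rw [smul_comm]
      · have h2 := le_antisymm h hs
        obtain ⟨i, j, -, hsum⟩ := exists_pair h2
        rw [hsum fun t => (g.hatLie n x y).1 t, hsum fun t => x.1 t, hsum fun t => y.1 t,
          hatLie_vertex, hatLie_vertex,
          lie_congr_left (x := x.1 {0}) (x' := x.1 {i}) hab (x.2.2.2 _ _)
            (by rw [map_sub, y.2.2.2 j i, sub_self]),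
          lie_congr_right (x := y.1 {0}) (x' := y.1 {j}) hab (y.2.2.2 _ _)
            (by rw [map_sub, x.2.2.2 j i, sub_self]), h2,
          show ((2 : ℕ) - 1 : ℤ) * q + q = 2 * q by push_cast; ring, zpow_mul]
        simp only [map_sub, LinearMap.sub_apply]
        norm_num
    rw [key]
    simp only [map_add, map_sub, map_smul, LinearMap.sub_apply, LinearMap.smul_apply]
    rw [e1, e2]
    generalize (s.card : ℤ) - 1 = l
    rw [mul_add, sub_eq_add_neg p l]
    simp only [zpow_add₀ (show (-1 : ℝ) ≠ 0 by norm_num), zpow_neg, mul_one]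
    rcases neg_one_zpow_cases p with h1 | h1 <;>
    rcases neg_one_zpow_cases q with h4 | h4 <;>
    rcases neg_one_zpow_cases l with h2 | h2 <;>
    rcases neg_one_zpow_cases (l * q) with h3 | h3 <;> rw [h1, h2, h3, h4] <;> norm_num <;> abel

theorem hat_anchor_d {k : ℤ} {f : g.hatCarrier n} (hf : f ∈ g.hatGr n k) :
    g.hatAnchor n (g.hatD n f) =
      A.d ∘ₗ g.hatAnchor n f - (-1 : ℝ) ^ k • (g.hatAnchor n f ∘ₗ A.d) := by
  change g.anchor ((g.hatD n f).1 {0}) = _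
  rw [hatD_vertex]
  exact g.anchor_d _ _ (hatGr_vertex hf 0)

theorem hat_anchor_lie {i j : ℤ} {f h : g.hatCarrier n} (hf : f ∈ g.hatGr n i)
    (hh : h ∈ g.hatGr n j) :
    g.hatAnchor n (g.hatLie n f h) = g.hatAnchor n f ∘ₗ g.hatAnchor n h -
      (-1 : ℝ) ^ (i * j) • (g.hatAnchor n h ∘ₗ g.hatAnchor n f) := by
  change g.anchor ((g.hatLie n f h).1 {0}) = _
  rw [hatLie_vertex]
  exact g.anchor_lie _ _ _ (hatGr_vertex hf 0) _ (hatGr_vertex hh 0)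

theorem hat_lie_smul (hab : g.HasAbelianKernel) {i j k : ℤ} {a : A} (ha : a ∈ A.gr i)
    {f h : g.hatCarrier n} (hf : f ∈ g.hatGr n j) (hh : h ∈ g.hatGr n k) :
    g.hatLie n f (a • h) =
      (-1 : ℝ) ^ (i * j) • (a • g.hatLie n f h) + g.hatAnchor n f a • h := by
  have hah : a • h ∈ g.hatGr n (i + k) := by
    intro s
    have := g.smul_mem i _ a ha _ (hh s)
    rwa [← add_sub_assoc] at this
  refine hat_ext (fun m => ?_) fun s hs => ?_
  · change (g.hatLie n f (a • h)).1 {m} =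
      (-1 : ℝ) ^ (i * j) • (a • (g.hatLie n f h).1 {m}) + g.anchor (f.1 {0}) a • h.1 {m}
    rw [hatLie_vertex, hatLie_vertex, f.2.2.2 0 m]
    exact g.lie_smul _ _ _ _ ha _ (hatGr_vertex hf m) _ (hatGr_vertex hh m)
  · change (g.hatLie n f (a • h)).1 s =
      (-1 : ℝ) ^ (i * j) • (a • (g.hatLie n f h).1 s) + g.anchor (f.1 {0}) a • h.1 s
    rw [hatLie_apply hab f hah hs 0, hatLie_apply hab f hh hs 0]
    change g.lie (f.1 {0}) (a • h.1 s) +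
      (-1 : ℝ) ^ (((s.card : ℤ) - 1) * (i + k)) • g.lie (f.1 s) (a • h.1 {0}) = _
    rw [g.lie_smul _ _ _ _ ha _ (hatGr_vertex hf 0) _ (hh s),
      g.lie_smul _ _ _ _ ha _ (hf s) _ (hatGr_vertex hh 0), f.2.2.1 s hs]
    generalize (s.card : ℤ) - 1 = l
    rw [LinearMap.zero_apply, zero_smul, add_zero, mul_add, mul_sub, sub_eq_add_neg,
      zpow_add₀ (by norm_num), zpow_add₀ (by norm_num), zpow_neg, mul_comm l i]
    simp only [smul_add, smul_comm a]
    rcases neg_one_zpow_cases (i * j) with h1 | h1 <;>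
    rcases neg_one_zpow_cases (i * l) with h2 | h2 <;>
    rcases neg_one_zpow_cases (l * k) with h3 | h3 <;> rw [h1, h2, h3] <;> norm_num <;> abel

variable (g n)

/-- The dg `A`-module `Hom_{T_A}(C_*(Δⁿ; ℝ), g)`. -/
noncomputable def hatModule : DGModule A where
  carrier := g.hatCarrier n
  gr := g.hatGr n
  smul_mem i j a ha f hf s := by
    have := g.smul_mem i _ a ha _ (hf s)
    rwa [← add_sub_assoc] at this
  d := g.hatD n
  d_mem k f hf := hatD_mem hf
  d_d := hatD_hatD
  d_smul i a ha f := by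
    have hsm : ∀ p : ℤ, ∀ f ∈ g.hatGr n p, a • f ∈ g.hatGr n (i + p) := by
      intro p f hf s
      have := g.smul_mem i _ a ha _ (hf s)
      rwa [← add_sub_assoc] at this
    induction f using graded_induction (gr := g.hatGr n) with
    | h0 => simp
    | hadd x y hx hy => rw [smul_add, map_add, hx, hy, map_add, smul_add, smul_add, smul_add]; abel
    | hm p f hf =>
      apply Subtype.ext
      funext s
      change _ = A.d a • f.1 s + (-1 : ℝ) ^ i • (a • (g.hatD n f).1 s)
      rw [hatD_apply (hsm p f hf), hatD_apply hf]
      change g.d (a • f.1 s) -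
        (-1 : ℝ) ^ (i + p) • ∑ r ∈ s, (-1 : ℝ) ^ facePos s r • (a • f.1 (s.erase r)) = _
      rw [g.d_smul i a ha, zpow_add₀ (by norm_num)]
      simp only [smul_sub, smul_comm _ a, ← Finset.smul_sum, mul_smul]
      abel

variable {g}

/-- The dg Lie algebroid `Hom_{T_A}(C_*(Δⁿ; ℝ), g)`, for a dg Lie algebroid `g` whose anchor has
abelian kernel. -/
noncomputable def hatObj (hab : g.HasAbelianKernel) : DGLieAlgebroid A where
  toDGModule := g.hatModule n
  lie := g.hatLie n
  lie_mem _ _ _ hf _ hh := hatLie_mem hab hf hh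
  lie_antisymm _ _ _ hf _ hh := hatLie_antisymm hab hf hh
  d_lie _ _ _ hf _ hh := hatD_lie hab hf hh
  lie_lie _ _ _ _ hf _ hh _ hk := hatLie_lie hab hf hh hk
  anchor := g.hatAnchor n
  anchor_mem _ _ hf := g.anchor_mem _ _ (hatGr_vertex hf 0)
  anchor_smul a f := g.anchor_smul a (f.1 {0})
  anchor_d _ _ hf := hat_anchor_d hf
  anchor_lie _ _ _ hf _ hh := hat_anchor_lie hf hh
  lie_smul _ _ _ _ ha _ hf _ hh := hat_lie_smul hab ha hf hh

variable {n} {m : ℕ}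

/-- The map induced by a monotone map `α : [m] → [n]`: precomposition with the map of chain
complexes which sends a face `t` to its image if `α` is injective on `t`, and to zero otherwise. -/
def hatMapFun (α : Fin (m + 1) →o Fin (n + 1)) (f : Finset (Fin (n + 1)) → g.carrier) :
    Finset (Fin (m + 1)) → g.carrier := fun t =>
  if (t.image α).card = t.card then f (t.image α) else 0

theorem hatMapFun_singleton (α : Fin (m + 1) →o Fin (n + 1))
    (f : Finset (Fin (n + 1)) → g.carrier) (i : Fin (m + 1)) :
    hatMapFun α f {i} = f {α i} := by
  simp [hatMapFun]

theorem hatMapFun_comp {k : ℕ} (α : Fin (m + 1) →o Fin (n + 1)) (β : Fin (k + 1) →o Fin (m + 1))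
    (f : Finset (Fin (n + 1)) → g.carrier) :
    hatMapFun β (hatMapFun α f) = hatMapFun (α.comp β) f := by
  funext t
  have e : t.image (α.comp β) = (t.image β).image α := by
    rw [Finset.image_image]
    rfl
  simp only [hatMapFun, e]
  have h1 : (t.image β).card ≤ t.card := Finset.card_image_le
  have h2 : ((t.image β).image α).card ≤ (t.image β).card := Finset.card_image_le
  split_ifs <;> first | rfl | omega

theorem hatMapFun_mem (α : Fin (m + 1) →o Fin (n + 1)) {f : Finset (Fin (n + 1)) → g.carrier}
    (hf : f ∈ g.hatCarrier n) : hatMapFun α f ∈ g.hatCarrier m := by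
  refine ⟨by simp [hatMapFun, hf.1], fun t ht => ?_, fun i j => ?_⟩
  · rw [hatMapFun]
    split_ifs with h
    · exact hf.2.1 _ (by omega)
    · exact map_zero _
  · rw [hatMapFun_singleton, hatMapFun_singleton]
    exact hf.2.2 _ _

/-- The `A`-linear map `Hom_{T_A}(C_*(Δⁿ; ℝ), g) → Hom_{T_A}(C_*(Δᵐ; ℝ), g)` induced by a
monotone map `[m] → [n]`. -/
def hatMap (α : Fin (m + 1) →o Fin (n + 1)) : g.hatCarrier n →ₗ[A.carrier] g.hatCarrier m where
  toFun f := ⟨hatMapFun α f.1, hatMapFun_mem α f.2⟩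
  map_add' f h := by
    apply Subtype.ext
    funext t
    change hatMapFun α (f + h).1 t = hatMapFun α f.1 t + hatMapFun α h.1 t
    simp only [hatMapFun]
    split_ifs
    · rfl
    · simp
  map_smul' a f := by
    apply Subtype.ext
    funext t
    change hatMapFun α (a • f).1 t = a • hatMapFun α f.1 t
    simp only [hatMapFun]
    split_ifs
    · rfl
    · simp

theorem hatMap_mem (α : Fin (m + 1) →o Fin (n + 1)) {k : ℤ} {f : g.hatCarrier n}
    (hf : f ∈ g.hatGr n k) : hatMap α f ∈ g.hatGr m k := by
  intro t
  change hatMapFun α f.1 t ∈ _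
  rw [hatMapFun]
  split_ifs with h
  · rw [← h]
    exact hf _
  · exact zero_mem _

theorem facePos_image {α : Fin (m + 1) →o Fin (n + 1)} {t : Finset (Fin (m + 1))}
    (h : Set.InjOn α t) {r : Fin (m + 1)} (hr : r ∈ t) :
    facePos (t.image α) (α r) = facePos t r := by
  rw [facePos, facePos, ← Finset.card_image_of_injOn (s := t.filter (· < r)) (f := α)
    (h.mono fun x hx => (Finset.mem_filter.1 hx).1)]
  congr 1
  ext x
  simp only [Finset.mem_filter, Finset.mem_image]
  constructor
  · rintro ⟨⟨y, hy, rfl⟩, hlt⟩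
    exact ⟨y, ⟨hy, lt_of_not_ge fun hge => not_le.2 hlt (α.monotone hge)⟩, rfl⟩
  · rintro ⟨y, ⟨hy, hlt⟩, rfl⟩
    exact ⟨⟨y, hy, rfl⟩, lt_of_le_of_ne (α.monotone hlt.le) fun he => hlt.ne (h hy hr he)⟩

theorem sum_hatMapFun (α : Fin (m + 1) →o Fin (n + 1)) (f : Finset (Fin (n + 1)) → g.carrier)
    (t : Finset (Fin (m + 1))) :
    ∑ r ∈ t, (-1 : ℝ) ^ facePos t r • hatMapFun α f (t.erase r) =
      if (t.image α).card = t.card then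
        ∑ r ∈ t.image α, (-1 : ℝ) ^ facePos (t.image α) r • f ((t.image α).erase r) else 0 := by
  split_ifs with h
  · rw [Finset.card_image_iff] at h
    rw [Finset.sum_image h]
    refine Finset.sum_congr rfl fun r hr => ?_
    have e : (t.erase r).image α = (t.image α).erase (α r) := by
      ext x
      simp only [Finset.mem_erase, Finset.mem_image]
      constructor
      · rintro ⟨y, ⟨hy, hyt⟩, rfl⟩
        exact ⟨fun he => hy (h hyt hr he), y, hyt, rfl⟩
      · rintro ⟨hx, y, hyt, rfl⟩
        exact ⟨y, ⟨fun he => hx (he ▸ rfl), hyt⟩, rfl⟩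
    rw [facePos_image h hr, hatMapFun, if_pos, e]
    rw [Finset.card_image_iff]
    exact h.mono (by simp)
  · rw [Finset.card_image_iff] at h
    have hz : ∀ q a b : Fin (m + 1), a ∈ t → b ∈ t → a ≠ b → α a = α b → q ≠ a → q ≠ b →
        hatMapFun α f (t.erase q) = 0 := by
      intro q a b ha hb hab hα hqa hqb
      rw [hatMapFun, if_neg]
      rw [Finset.card_image_iff]
      intro hinj
      exact hab (hinj (by simp [ha, hqa.symm]) (by simp [hb, hqb.symm]) hα)
    have hex : ∃ r ∈ t, ∃ r' ∈ t, r < r' ∧ α r = α r' := by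
      simp only [Set.InjOn] at h
      push Not at h
      obtain ⟨a, ha, b, hb, hα, hab⟩ := h
      rcases lt_or_gt_of_ne hab with hlt | hlt
      · exact ⟨a, ha, b, hb, hlt, hα⟩
      · exact ⟨b, hb, a, ha, hlt, hα.symm⟩
    obtain ⟨r, hr, r', hr', hlt, hα⟩ := hex
    rw [← Finset.sum_subset (s₁ := {r, r'})
      (by intro x hx; simp only [Finset.mem_insert, Finset.mem_singleton] at hx
          rcases hx with rfl | rfl <;> assumption)
      (by
        intro q _ hq
        simp only [Finset.mem_insert, Finset.mem_singleton, not_or] at hq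
        rw [hz q r r' hr hr' hlt.ne hα hq.1 hq.2, smul_zero]), Finset.sum_pair hlt.ne]
    by_cases hb : ∃ q ∈ t, r < q ∧ q < r'
    · obtain ⟨q, hq, h1, h2⟩ := hb
      have hq' : α r = α q := le_antisymm (α.monotone h1.le) (hα ▸ α.monotone h2.le)
      rw [hz r q r' hq hr' h2.ne (hq'.symm.trans hα) h1.ne hlt.ne,
        hz r' r q hr hq h1.ne hq' hlt.ne' h2.ne']
      simp
    · push Not at hb
      have hpos : facePos t r' = facePos t r + 1 := by
        rw [facePos, facePos, ← Finset.card_insert_of_notMem (a := r) (by simp)]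
        congr 1
        ext x
        simp only [Finset.mem_filter, Finset.mem_insert]
        constructor
        · rintro ⟨hx, hxr⟩
          rcases lt_trichotomy x r with h | h | h
          · exact Or.inr ⟨hx, h⟩
          · exact Or.inl h
          · exact absurd hxr (not_lt.2 (hb x hx h))
        · rintro (rfl | ⟨hx, hxr⟩)
          · exact ⟨hr, hlt⟩
          · exact ⟨hx, hxr.trans hlt⟩
      have himg : (t.erase r).image α = (t.erase r').image α := by
        ext x
        simp only [Finset.mem_erase, Finset.mem_image]
        constructor
        · rintro ⟨y, ⟨hy, hyt⟩, rfl⟩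
          by_cases hyr : y = r'
          · exact ⟨r, ⟨hlt.ne, hr⟩, by rw [hyr, hα]⟩
          · exact ⟨y, ⟨hyr, hyt⟩, rfl⟩
        · rintro ⟨y, ⟨hy, hyt⟩, rfl⟩
          by_cases hyr : y = r
          · exact ⟨r', ⟨hlt.ne', hr'⟩, by rw [hyr, hα]⟩
          · exact ⟨y, ⟨hyr, hyt⟩, rfl⟩
      have heq : hatMapFun α f (t.erase r) = hatMapFun α f (t.erase r') := by
        rw [hatMapFun, hatMapFun, himg, Finset.card_erase_of_mem hr, Finset.card_erase_of_mem hr']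
      rw [heq, hpos, pow_succ]
      module

theorem hatMap_d (α : Fin (m + 1) →o Fin (n + 1)) (f : g.hatCarrier n) :
    hatMap α (g.hatD n f) = g.hatD m (hatMap α f) := by
  induction f using graded_induction (gr := g.hatGr n) with
  | h0 => simp
  | hadd x y hx hy => rw [map_add, map_add, hx, hy, map_add, map_add]
  | hm p f hf =>
    apply Subtype.ext
    funext t
    rw [hatD_apply (hatMap_mem α hf)]
    change (if (t.image α).card = t.card then (g.hatD n f).1 (t.image α) else 0) =
      g.d (hatMapFun α f.1 t) -
        (-1 : ℝ) ^ p • ∑ r ∈ t, (-1 : ℝ) ^ facePos t r • hatMapFun α f.1 (t.erase r)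
    rw [sum_hatMapFun, hatMapFun]
    split_ifs
    · rw [hatD_apply hf]
    · simp

theorem hatMap_lie (α : Fin (m + 1) →o Fin (n + 1)) (f h : g.hatCarrier n) :
    hatMap α (g.hatLie n f h) = g.hatLie m (hatMap α f) (hatMap α h) := by
  apply Subtype.ext
  funext t
  change (if (t.image α).card = t.card then g.hatLieFun n f.1 h.1 (t.image α) else 0) =
    g.hatLieFun m (hatMapFun α f.1) (hatMapFun α h.1) t
  simp only [hatLieFun, hatMapFun_singleton]
  by_cases hc : (t.image α).card = t.card
  · simp only [hatMapFun, hc, if_true]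
    split_ifs
    · rfl
    · rw [Finset.sum_image (Finset.card_image_iff.1 hc)]
  · simp [hatMapFun, hc]

theorem hatMap_anchor (α : Fin (m + 1) →o Fin (n + 1)) (f : g.hatCarrier n) :
    g.hatAnchor m (hatMap α f) = g.hatAnchor n f := by
  change g.anchor (hatMapFun α f.1 {0}) = g.anchor (f.1 {0})
  rw [hatMapFun_singleton]
  exact f.2.2.2 _ _

/-- A strict map between dg Lie algebroids, as a map of `L∞`-algebroids. -/
def homMk {g h : DGLieAlgebroid A} (φ : g.carrier →ₗ[A.carrier] h.carrier)
    (hgr : ∀ k, ∀ x ∈ g.gr k, φ x ∈ h.gr k) (hd : ∀ x, φ (g.d x) = h.d (φ x))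
    (hlie : ∀ x y, φ (g.lie x y) = h.lie (φ x) (φ y))
    (hanchor : ∀ x, h.anchor (φ x) = g.anchor x) : g.toLInf ⟶ h.toLInf where
  toLinearMap := φ
  map_mem := hgr
  map_br k x := by
    match k with
    | 0 => exact hd _
    | 1 => exact hlie _ _
    | k + 2 => exact map_zero φ
  map_anchor := hanchor

/-- The simplicial dg Lie algebroid `Hom_{T_A}(C_*(Δ; ℝ), g)`, as a simplicial object in the category
of `L∞`-algebroids over `A`. -/
noncomputable def hat (g : DGLieAlgebroid A) (hab : g.HasAbelianKernel) :
    SimplicialObject (LInfAlgebroid A) where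
  obj Δ := (hatObj Δ.unop.len hab).toLInf
  map α := homMk (g := hatObj _ hab) (h := hatObj _ hab) (hatMap α.unop.toOrderHom)
    (fun _ _ h => hatMap_mem _ h) (hatMap_d _) (hatMap_lie _) (hatMap_anchor _)
  map_id Δ := by
    refine LInfAlgebroid.Hom.ext (LinearMap.ext fun f => Subtype.ext (funext fun t => ?_))
    change hatMapFun _ f.1 t = f.1 t
    simp [hatMapFun]
  map_comp α β := by
    refine LInfAlgebroid.Hom.ext (LinearMap.ext fun f => Subtype.ext (funext fun t => ?_))
    exact (congrFun (hatMapFun_comp α.unop.toOrderHom β.unop.toOrderHom f.1) t).symm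

/-- The map `g → Hom_{T_A}(C_*(Δⁿ; ℝ), g)` induced by `C_*(Δⁿ; ℝ) → C_*(Δ⁰; ℝ) = ℝ`. -/
def hatConst (n : ℕ) : g.carrier →ₗ[A.carrier] g.hatCarrier n where
  toFun x := ⟨fun s => if s.card = 1 then x else 0, by
    refine ⟨by simp, fun s hs => ?_, fun i j => by simp⟩
    have h0 : (if s.card = 1 then x else 0) = 0 := if_neg (by omega)
    exact (congrArg g.anchor h0).trans (map_zero _)⟩
  map_add' x y := by
    apply Subtype.ext
    funext s
    change (if s.card = 1 then x + y else 0) = (if s.card = 1 then x else 0) +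
      (if s.card = 1 then y else 0)
    split_ifs <;> simp
  map_smul' a x := by
    apply Subtype.ext
    funext s
    change (if s.card = 1 then a • x else 0) = a • (if s.card = 1 then x else 0)
    split_ifs <;> simp

theorem hatConst_vertex (x : g) (i : Fin (n + 1)) : (hatConst n x).1 {i} = x := by
  exact if_pos (e := (0 : g.carrier)) (Finset.card_singleton i)

theorem hatConst_pos (x : g) {s : Finset (Fin (n + 1))} (hs : 1 < s.card) :
    (hatConst n x).1 s = 0 := by
  exact if_neg (by omega)

theorem hatConst_d (x : g) : hatConst n (g.d x) = g.hatD n (hatConst n x) := by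
  refine hat_ext (fun i => ?_) fun s hs => ?_
  · rw [hatD_vertex, hatConst_vertex, hatConst_vertex]
  · change _ = g.hatDFun n _ s
    rw [hatConst_pos _ hs, hatDFun, hatConst_pos _ hs]
    rcases Nat.lt_or_ge 2 s.card with h | h
    · rw [Finset.sum_eq_zero fun r hr => ?_]
      · simp
      · rw [hatConst_pos _ (by rw [Finset.card_erase_of_mem hr]; omega)]
        simp
    · obtain ⟨i, j, -, hsum⟩ := exists_pair (g := g) (le_antisymm h hs)
      rw [hsum fun t => gradedSign g.gr ((hatConst n x).1 t), hatConst_vertex, hatConst_vertex]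
      simp

theorem hatConst_lie (x y : g) :
    hatConst n (g.lie x y) = g.hatLie n (hatConst n x) (hatConst n y) := by
  refine hat_ext (fun i => ?_) fun s hs => ?_
  · rw [hatLie_vertex, hatConst_vertex, hatConst_vertex, hatConst_vertex]
  · change _ = g.hatLieFun n _ _ s
    simp [hatConst_pos _ hs, hatLieFun, not_le.2 hs]

theorem hatConst_mem {k : ℤ} {x : g} (hx : x ∈ g.gr k) : hatConst n x ∈ g.hatGr n k := by
  intro s
  change (if s.card = 1 then x else 0) ∈ _
  split_ifs with h
  · simpa [h] using hx
  · exact zero_mem _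

/-- The canonical map from the constant simplicial object on `g`. -/
noncomputable def hatAugmentation (g : DGLieAlgebroid A) (hab : g.HasAbelianKernel) :
    (SimplicialObject.const (LInfAlgebroid A)).obj g.toLInf ⟶ g.hat hab where
  app Δ := homMk (h := hatObj Δ.unop.len hab) (hatConst _) (fun _ _ => hatConst_mem) hatConst_d
    hatConst_lie (fun x => congrArg g.anchor (hatConst_vertex x 0))
  naturality Δ Δ' α := by
    refine LInfAlgebroid.Hom.ext (LinearMap.ext fun x => Subtype.ext (funext fun t => ?_))
    change (if t.card = 1 then x else 0) =
      if (t.image α.unop.toOrderHom).card = t.card then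
        (if (t.image α.unop.toOrderHom).card = 1 then x else 0) else 0
    by_cases h : t.card = 1
    · obtain ⟨i, rfl⟩ := Finset.card_eq_one.1 h
      simp
    · by_cases h' : (t.image α.unop.toOrderHom).card = t.card
      · simp [h', h]
      · simp [h', h]

end DGLieAlgebroid

/-! ### Reedy fibrancy and simplicial resolutions -/

section Reedy

universe v w

variable {C : Type w} [Category.{v} C]

/-- The proper faces of the simplex `[n]`: injective maps `[m] → [n]` which are not
isomorphisms. -/
abbrev ProperFace (n : ℕ) : Type :=
  ObjectProperty.FullSubcategory fun f : Over (SimplexCategory.mk n) => Mono f.hom ∧ ¬ IsIso f.hom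

/-- The diagram of the values of a simplicial object on the proper faces of `[n]`; its limit is the
`n`-th matching object. -/
def matchingDiagram (X : SimplicialObject C) (n : ℕ) : (ProperFace n)ᵒᵖ ⥤ C :=
  (ObjectProperty.ι _ ⋙ Over.forget _).op ⋙ X

/-- The restriction maps from `X_n` to the values of `X` on the proper faces. -/
def matchingCone (X : SimplicialObject C) (n : ℕ) : Limits.Cone (matchingDiagram X n) where
  pt := X.obj (Opposite.op (SimplexCategory.mk n))
  π :=
    { app := fun j => X.map j.unop.obj.hom.op
      naturality := fun i j f => by
        change 𝟙 _ ≫ X.map j.unop.obj.hom.op = X.map i.unop.obj.hom.op ≫ X.map f.unop.hom.left.op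
        rw [Category.id_comp, ← X.map_comp, ← op_comp, Over.w] }

/-- A simplicial object is Reedy fibrant if for all `n` the matching object exists and the matching
map `X_n → M_n X` is a fibration. -/
def IsReedyFibrant [CategoryWithFibrations C] (X : SimplicialObject C) : Prop :=
  ∀ n, ∃ _ : Limits.HasLimit (matchingDiagram X n),
    Fibration (Limits.limit.lift (matchingDiagram X n) (matchingCone X n))

/-- A map from the constant simplicial object on `c` to `X` exhibits `X` as a (Reedy) fibrant
simplicial resolution of `c` if `X` is Reedy fibrant and the map is an objectwise weak
equivalence. -/
structure IsFibrantSimplicialResolution [CategoryWithFibrations C]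
    [CategoryWithWeakEquivalences C] {c : C} {X : SimplicialObject C}
    (η : (SimplicialObject.const C).obj c ⟶ X) : Prop where
  reedyFibrant : IsReedyFibrant X
  weakEquivalence : ∀ Δ, WeakEquivalence (η.app Δ)

end Reedy

namespace DGLieAlgebroid

variable {A : CDGA.{u}}

/-! ### Quotients of dg Lie algebroids -/

/-! Reedy fibrancy: existence of the matching object and surjectivity of the matching map come from
one argument. Given a cone whose point is a dg Lie algebroid `g`, divide `g` by the elements killed
by all legs and by the anchor. Suppose that every homogeneous element of every cone lifts to `g`,
compatibly with degree, legs and anchor. Then the quotient is a limit (`HasLifts.isLimit`): two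
lifts differ by an element of the joint kernel and brackets of lifts lift brackets, so sending an
element to the class of a lift is the unique map of cones. The comparison map from `g` to the limit
is then the quotient map, hence surjective (`HasLifts.exists_fibration`). The cones range over all
`L∞`-algebroids, but the limit obtained is a dg Lie algebroid.

For the matching diagram the lifts are found in `hat_hasLifts`. If `n > 0`, an element of a cone is
a compatible family of functions on the proper faces of the simplex; these glue to a function on all
proper nonempty subsets of the vertices, and the value on the top simplex may be chosen to be zero,
since a cochain of given degree is constrained only by degree and anchor. If `n = 0` there are no
proper faces, the limit is taken over the empty diagram, and a lift is just an element with
prescribed anchor: this is where fibrancy enters.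

Quasi-isomorphism: evaluation at the vertex `0` is a strict map and a left inverse of the inclusion
of the constant functions. The cone contraction `s ↦ {0} ∪ s` of the simplex gives a homotopy for
the other composite (`hatD_hatContract`, `hatHomotopy`). It respects the anchor conditions because
`{0} ∪ s` has positive weight whenever `s` is nonempty and does not contain `0`. -/

/-- A graded dg ideal of a dg Lie algebroid which is contained in the kernel of the anchor. -/
structure IsAnchoredIdeal (g : DGLieAlgebroid A) (I : Submodule A.carrier g.carrier) : Prop where
  proj_mem : ∀ k, ∀ x ∈ I, gradedProj g.gr k x ∈ I
  d_mem : ∀ x ∈ I, g.d x ∈ I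
  lie_mem_left : ∀ x ∈ I, ∀ y, g.lie x y ∈ I
  lie_mem_right : ∀ x, ∀ y ∈ I, g.lie x y ∈ I
  anchor_eq_zero : ∀ x ∈ I, g.anchor x = 0

variable {g : DGLieAlgebroid A} {I : Submodule A.carrier g.carrier}

/-- The real linear map on `g ⧸ I` induced by a real linear map which vanishes on `I`. -/
noncomputable def quotLift (I : Submodule A.carrier g.carrier) {V : Type*} [AddCommGroup V]
    [Module ℝ V] (φ : g.carrier →ₗ[ℝ] V) (h : ∀ x ∈ I, φ x = 0) : (g.carrier ⧸ I) →ₗ[ℝ] V :=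
  (I.restrictScalars ℝ).liftQ φ h ∘ₗ
    (Submodule.Quotient.restrictScalarsEquiv ℝ I).symm.toLinearMap

/-- The grading of a quotient. -/
def quotGr (I : Submodule A.carrier g.carrier) (k : ℤ) : Submodule ℝ (g.carrier ⧸ I) :=
  (g.gr k).map (I.mkQ.restrictScalars ℝ)

theorem mkQ_mem_quotGr {k : ℤ} {x : g.carrier} (hx : x ∈ g.gr k) : I.mkQ x ∈ quotGr I k :=
  ⟨x, hx, rfl⟩

/-- Since `I` is graded, the projections of `g` descend to the quotient, and `isInternal_of_proj`
recognises a grading from its projections. -/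
theorem quot_isInternal (hI : g.IsAnchoredIdeal I) : DirectSum.IsInternal (quotGr I) := by
  refine isInternal_of_proj _
    (fun k => quotLift I (I.mkQ.restrictScalars ℝ ∘ₗ gradedProj g.gr k) fun x hx =>
      (Submodule.Quotient.mk_eq_zero I).2 (hI.proj_mem k x hx)) ?_ ?_ ?_ ?_
  · intro k x
    obtain ⟨x, rfl⟩ := I.mkQ_surjective x
    exact mkQ_mem_quotGr (gradedProj_mem k x)
  · rintro k _ ⟨x, hx, rfl⟩
    exact congrArg I.mkQ (gradedProj_same hx)
  · rintro k j hkj _ ⟨x, hx, rfl⟩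
    exact (congrArg I.mkQ (gradedProj_ne hx hkj)).trans (map_zero _)
  · intro x
    obtain ⟨x, rfl⟩ := I.mkQ_surjective x
    obtain ⟨S, hS⟩ := finite_gradedProj (gr := g.gr) x
    refine ⟨S, ?_⟩
    conv_rhs => rw [← hS S subset_rfl, map_sum]
    rfl

/-- The dg module underlying a quotient. -/
noncomputable def quotModule (hI : g.IsAnchoredIdeal I) : DGModule A where
  carrier := g.carrier ⧸ I
  gr := quotGr I
  decomposition := (quot_isInternal hI).chooseDecomposition
  smul_mem := by
    -- A homogeneous element of the quotient is by definition the class of a homogeneous element of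
    -- the same degree, so each axiom here and in `quotient` is the image of the one in `g`.
    rintro i j a ha _ ⟨x, hx, rfl⟩
    exact mkQ_mem_quotGr (g.smul_mem i j a ha x hx)
  d := quotLift I (I.mkQ.restrictScalars ℝ ∘ₗ g.d) fun x hx =>
    (Submodule.Quotient.mk_eq_zero I).2 (hI.d_mem x hx)
  d_mem := by
    rintro k _ ⟨x, hx, rfl⟩
    exact mkQ_mem_quotGr (g.d_mem k x hx)
  d_d x := by
    obtain ⟨x, rfl⟩ := I.mkQ_surjective x
    exact (congrArg I.mkQ (g.d_d x)).trans (map_zero _)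
  d_smul := by
    intro i a ha x
    obtain ⟨x, rfl⟩ := I.mkQ_surjective x
    exact congrArg I.mkQ (g.d_smul i a ha x)

/-- The quotient of a dg Lie algebroid by a graded dg ideal contained in the kernel of the
anchor. -/
noncomputable def quotient (hI : g.IsAnchoredIdeal I) : DGLieAlgebroid A where
  toDGModule := quotModule hI
  -- The bracket descends one argument at a time: the inner lift uses that `I` is an ideal on the
  -- right, the outer one that it is an ideal on the left.
  lie := quotLift I
    { toFun := fun x => quotLift I (I.mkQ.restrictScalars ℝ ∘ₗ g.lie x) fun y hy =>
        (Submodule.Quotient.mk_eq_zero I).2 (hI.lie_mem_right x y hy)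
      map_add' := fun x y => by
        ext z
        obtain ⟨z, rfl⟩ := I.mkQ_surjective z
        change I.mkQ (g.lie (x + y) z) = I.mkQ (g.lie x z) + I.mkQ (g.lie y z)
        rw [map_add, LinearMap.add_apply, map_add]
      map_smul' := fun c x => by
        ext z
        obtain ⟨z, rfl⟩ := I.mkQ_surjective z
        change I.mkQ (g.lie (c • x) z) = c • I.mkQ (g.lie x z)
        rw [map_smul]
        rfl }
    fun x hx => by
      ext z
      obtain ⟨z, rfl⟩ := I.mkQ_surjective z
      exact (Submodule.Quotient.mk_eq_zero I).2 (hI.lie_mem_left x hx z)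
  lie_mem := by
    rintro i j _ ⟨x, hx, rfl⟩ _ ⟨y, hy, rfl⟩
    exact mkQ_mem_quotGr (g.lie_mem i j x hx y hy)
  lie_antisymm := by
    rintro i j _ ⟨x, hx, rfl⟩ _ ⟨y, hy, rfl⟩
    exact congrArg I.mkQ (g.lie_antisymm i j x hx y hy)
  d_lie := by
    rintro i j _ ⟨x, hx, rfl⟩ _ ⟨y, hy, rfl⟩
    exact congrArg I.mkQ (g.d_lie i j x hx y hy)
  lie_lie := by
    rintro i j k _ ⟨x, hx, rfl⟩ _ ⟨y, hy, rfl⟩ _ ⟨z, hz, rfl⟩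
    exact congrArg I.mkQ (g.lie_lie i j k x hx y hy z hz)
  anchor := quotLift I g.anchor hI.anchor_eq_zero
  anchor_mem := by
    rintro k _ ⟨x, hx, rfl⟩
    exact g.anchor_mem k x hx
  anchor_smul a x := by
    obtain ⟨x, rfl⟩ := I.mkQ_surjective x
    exact g.anchor_smul a x
  anchor_d := by
    rintro k _ ⟨x, hx, rfl⟩
    exact g.anchor_d k x hx
  anchor_lie := by
    rintro i j _ ⟨x, hx, rfl⟩ _ ⟨y, hy, rfl⟩
    exact g.anchor_lie i j x hx y hy
  lie_smul := by
    rintro i j k a ha _ ⟨x, hx, rfl⟩ _ ⟨y, hy, rfl⟩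
    exact congrArg I.mkQ (g.lie_smul i j k a ha x hx y hy)

theorem quotient_br (hI : g.IsAnchoredIdeal I) (k : ℕ) (x : Fin (k + 1) → g.carrier) :
    (quotient hI).br k (fun p => I.mkQ (x p)) = I.mkQ (g.br k x) := by
  match k with
  | 0 => rfl
  | 1 => rfl
  | k + 2 => exact (map_zero I.mkQ).symm

end DGLieAlgebroid

/-! ### Multilinear maps of graded vector spaces -/

/-- Each argument is a finite sum of homogeneous components, and both maps expand over these sums.
This is needed because axioms with Koszul signs speak of homogeneous arguments only. -/
theorem MultilinearMap.ext_of_homogeneous {ι M N : Type*} [Fintype ι] [AddCommGroup M] [Module ℝ M]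
    [AddCommGroup N] [Module ℝ N] (gr : ℤ → Submodule ℝ M) [DirectSum.Decomposition gr]
    {f f' : MultilinearMap ℝ (fun _ : ι => M) N}
    (h : ∀ (deg : ι → ℤ) (x : ι → M), (∀ p, x p ∈ gr (deg p)) → f x = f' x) : f = f' := by
  classical
  ext x
  choose S hS using fun p => finite_gradedProj (gr := gr) (x p)
  have hx : x = fun p => ∑ k ∈ S p, gradedProj gr k (x p) :=
    funext fun p => (hS p _ subset_rfl).symm
  rw [hx, MultilinearMap.map_sum_finset, MultilinearMap.map_sum_finset]
  exact Finset.sum_congr rfl fun r _ => h r _ fun p => gradedProj_mem _ _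

/-! ### Limits as quotients -/

namespace LInfAlgebroid

variable {A : CDGA.{u}}

theorem Hom.map_proj {g h : LInfAlgebroid A} (f : Hom g h) (k : ℤ) (x : g) :
    f.toLinearMap (gradedProj g.gr k x) = gradedProj h.gr k (f.toLinearMap x) := by
  refine graded_induction (gr := g.gr) (by simp) (fun x y hx hy => ?_) (fun j x hx => ?_) x
  · simp only [map_add, hx, hy]
  · by_cases hj : j = k
    · subst hj
      rw [gradedProj_same hx, gradedProj_same (f.map_mem _ _ hx)]
    · rw [gradedProj_ne hx hj, gradedProj_ne (f.map_mem _ _ hx) hj, map_zero]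

end LInfAlgebroid

namespace DGLieAlgebroid

variable {A : CDGA.{u}} {J : Type*} [Category J] {F : J ⥤ LInfAlgebroid A} {g : DGLieAlgebroid A}

/-- The leg at `j` of a cone with point `g`, as a linear map. -/
def leg (π : (Functor.const J).obj g.toLInf ⟶ F) (j : J) :
    g.carrier →ₗ[A.carrier] (F.obj j).carrier :=
  LInfAlgebroid.Hom.toLinearMap (π.app j)

variable (π : (Functor.const J).obj g.toLInf ⟶ F)

/-- The elements with anchor zero which are sent to zero by all legs of a cone. -/
def jointKernel : Submodule A.carrier g.carrier where
  -- The anchor condition follows from the others as soon as there is one leg; it is imposed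
  -- separately because the diagram may be empty.
  carrier := {x | (∀ j, leg π j x = 0) ∧ g.anchor x = 0}
  zero_mem' := by simp
  add_mem' := by
    rintro x y ⟨h1, h2⟩ ⟨h3, h4⟩
    exact ⟨fun j => by simp [h1 j, h3 j], by simp [h2, h4]⟩
  smul_mem' := by
    rintro a x ⟨h1, h2⟩
    exact ⟨fun j => by simp [h1 j], by rw [g.anchor_smul, h2, LinearMap.comp_zero]⟩

theorem leg_br (j : J) (k : ℕ) (x : Fin (k + 1) → g.carrier) :
    leg π j (g.br k x) = (F.obj j).br k fun p => leg π j (x p) :=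
  LInfAlgebroid.Hom.map_br (π.app j) k x

theorem leg_lie (j : J) (x y : g.carrier) :
    leg π j (g.lie x y) = (F.obj j).br 1 fun p => leg π j (![x, y] p) :=
  leg_br π j 1 ![x, y]

/-- Strict maps preserve degrees and all brackets, and a multilinear map vanishes when one argument
does; the kernel of the anchor is itself stable under projections, differential and brackets with
arbitrary elements. -/
theorem jointKernel_isAnchoredIdeal : g.IsAnchoredIdeal (jointKernel π) where
  proj_mem k x hx := by
    refine ⟨fun j => ?_, ?_⟩
    · have := LInfAlgebroid.Hom.map_proj (π.app j) k x
      exact this.trans ((congrArg _ (hx.1 j)).trans (map_zero _))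
    · rw [g.anchor_proj_congr (y := 0) (by rw [hx.2, map_zero]), map_zero, map_zero]
  d_mem x hx := by
    refine ⟨fun j => ?_, ?_⟩
    · have := LInfAlgebroid.Hom.map_d (π.app j) x
      exact this.trans ((congrArg _ (hx.1 j)).trans (map_zero _))
    · rw [g.anchor_d_congr (y := 0) (by rw [hx.2, map_zero]), map_zero, map_zero]
  lie_mem_left x hx y := by
    refine ⟨fun j => ?_, anchor_lie_eq_zero (Or.inl hx.2)⟩
    rw [leg_lie]
    exact MultilinearMap.map_coord_zero _ 0 (hx.1 j)
  lie_mem_right x y hy := by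
    refine ⟨fun j => ?_, anchor_lie_eq_zero (Or.inr hy.2)⟩
    rw [leg_lie]
    exact MultilinearMap.map_coord_zero _ 1 (hy.1 j)
  anchor_eq_zero x hx := hx.2

/-- The quotient of the point of a cone by the joint kernel of its legs and the anchor. -/
noncomputable abbrev image : DGLieAlgebroid A := quotient (jointKernel_isAnchoredIdeal π)

/-- The cone with point the quotient by the joint kernel. -/
noncomputable def imageCone : Limits.Cone F where
  pt := (image π).toLInf
  π :=
    { app := fun j =>
        { toLinearMap := (jointKernel π).liftQ (leg π j) fun x hx => hx.1 j
          map_mem := by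
            rintro k _ ⟨x, hx, rfl⟩
            exact LInfAlgebroid.Hom.map_mem (π.app j) k x hx
          map_br := fun k x => by
            choose y hy using fun p => (jointKernel π).mkQ_surjective (x p)
            obtain rfl : (fun p => (jointKernel π).mkQ (y p)) = x := funext hy
            exact (congrArg _ (quotient_br _ k y)).trans (leg_br π j k y)
          map_anchor := fun x => by
            obtain ⟨x, rfl⟩ := (jointKernel π).mkQ_surjective x
            exact LInfAlgebroid.Hom.map_anchor (π.app j) x }
      naturality := fun i j f => by
        refine LInfAlgebroid.Hom.ext (LinearMap.ext fun x => ?_)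
        obtain ⟨x, rfl⟩ := (jointKernel π).mkQ_surjective x
        exact congrArg (fun φ => LInfAlgebroid.Hom.toLinearMap φ x) (π.naturality f) }

/-! ### Lifts of elements of cones and the universal property of the quotient -/

/-- An element `y` of the point of a cone which lifts the element `x` of another cone. -/
def IsLift (s : Limits.Cone F) (x : s.pt.carrier) (y : g.carrier) : Prop :=
  (∀ j, leg π j y = LInfAlgebroid.Hom.toLinearMap (s.π.app j) x) ∧ g.anchor y = s.pt.anchor x

variable {π}

theorem IsLift.add {s : Limits.Cone F} {x x' : s.pt.carrier} {y y' : g.carrier}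
    (h : IsLift π s x y) (h' : IsLift π s x' y') : IsLift π s (x + x') (y + y') :=
  ⟨fun j => by rw [map_add, map_add, h.1, h'.1], by rw [map_add, map_add, h.2, h'.2]⟩

theorem IsLift.smul {s : Limits.Cone F} {x : s.pt.carrier} {y : g.carrier}
    (h : IsLift π s x y) (a : A) : IsLift π s (a • x) (a • y) :=
  ⟨fun j => by rw [map_smul, map_smul, h.1],
    by rw [g.anchor_smul, LInfAlgebroid.anchor_smul, h.2]⟩

/-- The difference of two lifts is killed by all legs and by the anchor. Well-definedness,
linearity, compatibility with brackets and uniqueness of the map into the quotient all rest on this.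
-/
theorem IsLift.mkQ_eq {s : Limits.Cone F} {x : s.pt.carrier} {y y' : g.carrier}
    (h : IsLift π s x y) (h' : IsLift π s x y') :
    (jointKernel π).mkQ y = (jointKernel π).mkQ y' :=
  (Submodule.Quotient.eq _).2
    ⟨fun j => by rw [map_sub, h.1, h'.1, sub_self], by rw [map_sub, h.2, h'.2, sub_self]⟩

/-- The legs of both cones commute with brackets. The anchor of a bracket is determined by the
anchors of the arguments in arities one and two, and is zero in higher arities, even though the
higher brackets of `s.pt` itself need not vanish. -/
theorem IsLift.br {s : Limits.Cone F} {k : ℕ} {deg : Fin (k + 1) → ℤ}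
    {x : Fin (k + 1) → s.pt.carrier} {y : Fin (k + 1) → g.carrier}
    (hx : ∀ p, x p ∈ s.pt.gr (deg p)) (hy : ∀ p, y p ∈ g.gr (deg p))
    (h : ∀ p, IsLift π s (x p) (y p)) : IsLift π s (s.pt.br k x) (g.br k y) := by
  refine ⟨fun j => ?_, ?_⟩
  · rw [leg_br]
    exact (congrArg _ (funext fun p => (h p).1 j)).trans
      (LInfAlgebroid.Hom.map_br (s.π.app j) k x).symm
  · match k with
    | 0 => rw [s.pt.br_zero, br_zero_eq, s.pt.anchor_d _ _ (hx 0), g.anchor_d _ _ (hy 0), (h 0).2]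
    | 1 =>
      have e : x = ![x 0, x 1] := by
        funext p; fin_cases p <;> rfl
      rw [e, s.pt.anchor_br_one _ _ _ (hx 0) _ (hx 1), br_one_eq,
        g.anchor_lie _ _ _ (hy 0) _ (hy 1), (h 0).2, (h 1).2]
    | k + 2 =>
      rw [s.pt.anchor_br _ (by omega), g.br_two (by omega)]
      exact map_zero g.anchor

variable (π) in
/-- Homogeneous elements of cones lift to homogeneous elements. -/
def HasLifts : Prop :=
  ∀ (s : Limits.Cone F) (k : ℤ), ∀ x ∈ s.pt.gr k, ∃ y ∈ g.gr k, IsLift π s x y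

theorem HasLifts.exists_isLift (H : HasLifts π) (s : Limits.Cone F) (x : s.pt.carrier) :
    ∃ y, IsLift π s x y := by
  refine graded_induction (gr := s.pt.gr) ⟨0, fun j => by simp, by simp⟩ ?_ ?_ x
  · rintro x x' ⟨y, hy⟩ ⟨y', hy'⟩
    exact ⟨y + y', hy.add hy'⟩
  · intro k x hx
    obtain ⟨y, -, hy⟩ := H s k x hx
    exact ⟨y, hy⟩

/-- The map from the point of a cone to the quotient by the joint kernel, as a linear map. -/
noncomputable def HasLifts.liftLinearMap (H : HasLifts π) (s : Limits.Cone F) :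
    s.pt.carrier →ₗ[A.carrier] (g.carrier ⧸ jointKernel π) where
  toFun x := (jointKernel π).mkQ (H.exists_isLift s x).choose
  map_add' x x' := by
    rw [← map_add]
    exact (H.exists_isLift s _).choose_spec.mkQ_eq
      ((H.exists_isLift s x).choose_spec.add (H.exists_isLift s x').choose_spec)
  map_smul' a x := by
    rw [← map_smul]
    exact (H.exists_isLift s _).choose_spec.mkQ_eq ((H.exists_isLift s x).choose_spec.smul a)

theorem HasLifts.liftLinearMap_eq (H : HasLifts π) {s : Limits.Cone F} {x : s.pt.carrier}
    {y : g.carrier} (h : IsLift π s x y) : H.liftLinearMap s x = (jointKernel π).mkQ y :=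
  (H.exists_isLift s x).choose_spec.mkQ_eq h

/-- The map from the point of a cone to the quotient by the joint kernel. -/
noncomputable def HasLifts.lift (H : HasLifts π) (s : Limits.Cone F) :
    s.pt ⟶ (image π).toLInf where
  toLinearMap := H.liftLinearMap s
  map_mem k x hx := by
    obtain ⟨y, hy, h⟩ := H s k x hx
    change H.liftLinearMap s x ∈ quotGr _ k
    rw [H.liftLinearMap_eq h]
    exact mkQ_mem_quotGr hy
  map_br k := by
    -- The claim is phrased as an equality of multilinear maps so that it need only be checked on
    -- homogeneous arguments, where homogeneous lifts exist and `IsLift.br` applies.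
    have key : ((H.liftLinearMap s).restrictScalars ℝ).compMultilinearMap (s.pt.br k) =
        ((image π).br k).compLinearMap fun _ => (H.liftLinearMap s).restrictScalars ℝ := by
      refine MultilinearMap.ext_of_homogeneous s.pt.gr fun deg x hx => ?_
      choose y hy h using fun p => H s (deg p) (x p) (hx p)
      change H.liftLinearMap s (s.pt.br k x) = (image π).br k fun p => H.liftLinearMap s (x p)
      rw [H.liftLinearMap_eq (IsLift.br hx hy h), ← quotient_br (jointKernel_isAnchoredIdeal π)]
      exact congrArg _ (funext fun p => (H.liftLinearMap_eq (h p)).symm)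
    exact fun x => congrArg (fun f => f x) key
  map_anchor x := by
    obtain ⟨y, hy⟩ := H.exists_isLift s x
    exact (congrArg (quotLift (jointKernel π) g.anchor fun x hx => hx.2)
      (H.liftLinearMap_eq hy)).trans hy.2

/-- If homogeneous elements of cones lift, the quotient by the joint kernel is a limit. -/
noncomputable def HasLifts.isLimit (H : HasLifts π) : Limits.IsLimit (imageCone π) where
  lift s := H.lift s
  fac s j := by
    refine LInfAlgebroid.Hom.ext (LinearMap.ext fun x => ?_)
    obtain ⟨y, hy⟩ := H.exists_isLift s x
    exact (congrArg ((jointKernel π).liftQ (leg π j) fun x hx => hx.1 j)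
      (H.liftLinearMap_eq hy)).trans (hy.1 j)
  uniq s m hm := by
    refine LInfAlgebroid.Hom.ext (LinearMap.ext fun x => ?_)
    obtain ⟨y, hy⟩ := (jointKernel π).mkQ_surjective (LInfAlgebroid.Hom.toLinearMap m x)
    -- Any representative of the value of a competing map `m` is a lift of `x`, because `m` respects
    -- legs and anchors; uniqueness follows.
    have h : IsLift π s x y := by
      refine ⟨fun j => ?_, ?_⟩
      · rw [← hm j]
        exact congrArg ((jointKernel π).liftQ (leg π j) fun x hx => hx.1 j) hy
      · rw [← LInfAlgebroid.Hom.map_anchor m x, ← hy]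
        rfl
    exact hy.symm.trans (H.liftLinearMap_eq h).symm

/-- For the cone with point `g`, each element is its own lift, so the induced map to the model
`imageCone` is the quotient map, which is surjective in each degree. This transports along the
isomorphism with the chosen limit. -/
theorem HasLifts.exists_fibration (H : HasLifts π) :
    ∃ _ : Limits.HasLimit F, Fibration (Limits.limit.lift F ⟨g.toLInf, π⟩) := by
  have hF : Limits.HasLimit F := ⟨⟨⟨_, H.isLimit⟩⟩⟩
  refine ⟨hF, (fibration_iff _).2 fun k y hy => ?_⟩
  let e := (Limits.limit.isLimit F).conePointUniqueUpToIso H.isLimit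
  have he : Limits.limit.lift F ⟨g.toLInf, π⟩ ≫ e.hom = H.lift ⟨g.toLInf, π⟩ :=
    (Limits.limit.isLimit F).lift_comp_conePointUniqueUpToIso_hom H.isLimit
  -- Lying in degree `k` of the quotient means being the class of some `x` of degree `k`; this `x`
  -- is the required preimage.
  obtain ⟨x, hx, hxy⟩ := LInfAlgebroid.Hom.map_mem e.hom k y hy
  refine ⟨x, hx, ?_⟩
  have h1 : LInfAlgebroid.Hom.toLinearMap (Limits.limit.lift F ⟨g.toLInf, π⟩ ≫ e.hom) x =
      LInfAlgebroid.Hom.toLinearMap e.hom y := by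
    rw [he]
    exact (H.liftLinearMap_eq (s := ⟨g.toLInf, π⟩) ⟨fun _ => rfl, rfl⟩).trans hxy
  have h2 : ∀ z, LInfAlgebroid.Hom.toLinearMap e.inv (LInfAlgebroid.Hom.toLinearMap e.hom z) = z :=
    fun z => congrArg (fun φ => LInfAlgebroid.Hom.toLinearMap φ z) e.hom_inv_id
  rw [← h2 y, ← h1]
  exact (h2 _).symm

end DGLieAlgebroid

/-! ### Proper faces and subsets -/

namespace ProperFace

variable {n : ℕ}

/-- The number of vertices of a face, minus one. -/
abbrev dim (j : ProperFace n) : ℕ := j.obj.left.len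

/-- The inclusion of the vertices of a face. -/
def vertexMap (j : ProperFace n) : Fin (j.dim + 1) →o Fin (n + 1) := j.obj.hom.toOrderHom

theorem vertexMap_injective (j : ProperFace n) : Function.Injective j.vertexMap :=
  SimplexCategory.mono_iff_injective.1 j.property.1

/-- A monotone injection that hits every vertex is an isomorphism, which properness excludes. -/
theorem image_vertexMap_ne_univ (j : ProperFace n) (u : Finset (Fin (j.dim + 1))) :
    u.image j.vertexMap ≠ Finset.univ := by
  intro h
  refine j.property.2 (SimplexCategory.isIso_of_bijective ⟨j.vertexMap_injective, fun y => ?_⟩)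
  obtain ⟨x, -, hx⟩ := Finset.mem_image.1 (h ▸ Finset.mem_univ y)
  exact ⟨x, hx⟩

/-- The face with a given set of vertices. -/
def ofFinset {l : ℕ} (t : Finset (Fin (n + 1))) (h : t.card = l + 1) (ht : t ≠ Finset.univ) :
    ProperFace n where
  obj := Over.mk (Y := SimplexCategory.mk l)
    (SimplexCategory.Hom.mk (t.orderEmbOfFin h).toOrderHom)
  property := by
    refine ⟨SimplexCategory.mono_iff_injective.2 (t.orderEmbOfFin h).injective, fun hi => ht ?_⟩
    have hs : Function.Surjective (t.orderEmbOfFin h) :=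
      SimplexCategory.epi_iff_surjective.1 (@IsIso.epi_of_iso _ _ _ _ _ hi)
    rw [← Finset.coe_eq_univ, ← Finset.range_orderEmbOfFin t h, hs.range_eq]

/-- The inclusion of the face with vertices the image of `u`. -/
def ofFinsetHom {l : ℕ} (j : ProperFace n) (u : Finset (Fin (j.dim + 1))) (hu : u.card = l + 1)
    (h : (u.image j.vertexMap).card = l + 1) (ht : u.image j.vertexMap ≠ Finset.univ) :
    ofFinset (u.image j.vertexMap) h ht ⟶ j where
  hom := Over.homMk (U := (ofFinset (u.image j.vertexMap) h ht).obj)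
    (SimplexCategory.Hom.mk (u.orderEmbOfFin hu).toOrderHom : SimplexCategory.mk l ⟶ j.obj.left) (by
      apply SimplexCategory.Hom.ext
      ext1
      -- The triangle over `[n]` commutes because a finite set has only one increasing enumeration,
      -- and a strictly increasing map carries that of `u` to that of its image.
      refine Finset.orderEmbOfFin_unique h (f := j.vertexMap ∘ u.orderEmbOfFin hu) (fun x => ?_)
        (j.vertexMap.monotone.strictMono_of_injective j.vertexMap_injective |>.comp
          (u.orderEmbOfFin hu).strictMono)
      exact Finset.mem_image_of_mem _ (Finset.orderEmbOfFin_mem u hu x))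

/-- An injection of a nonempty set into a point is bijective. Hence the matching diagram for `n = 0`
is empty. -/
instance : IsEmpty (ProperFace 0) where
  false j := j.property.2 (SimplexCategory.isIso_of_bijective
    ⟨j.vertexMap_injective, fun _ => ⟨0, Subsingleton.elim (α := Fin 1) _ _⟩⟩)

end ProperFace

/-! ### Reedy fibrancy -/

namespace DGLieAlgebroid

variable {A : CDGA.{u}} {g : DGLieAlgebroid A} {hab : g.HasAbelianKernel} {n : ℕ}

/-- The component at a proper face of an element of a cone over the matching diagram. -/
noncomputable def faceValue (s : Limits.Cone (matchingDiagram (g.hat hab) n)) (x : s.pt.carrier)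
    (j : ProperFace n) : g.hatCarrier j.dim :=
  LInfAlgebroid.Hom.toLinearMap (s.π.app (Opposite.op j)) x

variable (s : Limits.Cone (matchingDiagram (g.hat hab) n)) (x : s.pt.carrier)

theorem faceValue_mem {k : ℤ} (hx : x ∈ s.pt.gr k) (j : ProperFace n) :
    faceValue s x j ∈ g.hatGr j.dim k :=
  LInfAlgebroid.Hom.map_mem (s.π.app (Opposite.op j)) k x hx

theorem hatAnchor_faceValue (j : ProperFace n) :
    g.hatAnchor j.dim (faceValue s x j) = s.pt.anchor x :=
  LInfAlgebroid.Hom.map_anchor (s.π.app (Opposite.op j)) x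

theorem hatMap_faceValue {j j' : ProperFace n} (φ : j' ⟶ j) :
    hatMap φ.hom.left.toOrderHom (faceValue s x j) = faceValue s x j' :=
  congrArg (fun ψ => LInfAlgebroid.Hom.toLinearMap ψ x) (s.w φ.op)

/-- The function on subsets glued from an element of a cone over the matching diagram; it is zero
on the top-dimensional face. -/
noncomputable def glueFun (t : Finset (Fin (n + 1))) : g.carrier :=
  open Classical in
  -- With truncated subtraction the first condition says that `t` is nonempty, in the form that
  -- `ofFinset` expects for a face of dimension `t.card - 1`.
  if h : t.card = t.card - 1 + 1 ∧ t ≠ Finset.univ then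
    (faceValue s x (.ofFinset t h.1 h.2)).1 Finset.univ else 0

/-- The face spanned by the image of `u` maps to `j` with image `u`, so the cone condition
identifies its component with the restriction of the component at `j`. Evaluating on the top simplex
of the smaller face gives the value at `u`. -/
theorem glueFun_image (j : ProperFace n) (u : Finset (Fin (j.dim + 1))) :
    glueFun s x (u.image j.vertexMap) = (faceValue s x j).1 u := by
  rcases u.eq_empty_or_nonempty with rfl | hu
  · rw [(faceValue s x j).2.1, glueFun, dif_neg]
    simp
  · have hc : (u.image j.vertexMap).card = u.card :=
      Finset.card_image_of_injective _ j.vertexMap_injective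
    have hp := hu.card_pos
    have h : (u.image j.vertexMap).card = (u.image j.vertexMap).card - 1 + 1 := by omega
    have ht := j.image_vertexMap_ne_univ u
    rw [glueFun, dif_pos ⟨h, ht⟩, ← hatMap_faceValue s x (j.ofFinsetHom u (by omega) h ht)]
    have hu' : u.card = (u.image j.vertexMap).card - 1 + 1 := by omega
    have himg : Finset.univ.image (u.orderEmbOfFin hu') = u := by
      rw [← Finset.coe_inj, Finset.coe_image, Finset.coe_univ, Set.image_univ,
        Finset.range_orderEmbOfFin]
    change (if (Finset.univ.image (u.orderEmbOfFin hu')).card = Finset.univ.card then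
      (faceValue s x j).1 (Finset.univ.image (u.orderEmbOfFin hu')) else 0) = _
    rw [himg, if_pos]
    rw [Finset.card_univ, Fintype.card_fin]
    exact hu'

/-- Taking the face spanned by `t` and its top simplex reduces every property of the glued function
to one of the components. -/
theorem exists_image_eq {t : Finset (Fin (n + 1))} (ht : t.Nonempty) (ht' : t ≠ Finset.univ) :
    ∃ (j : ProperFace n) (u : Finset (Fin (j.dim + 1))), u.image j.vertexMap = t := by
  have hp := ht.card_pos
  have h : t.card = t.card - 1 + 1 := by omega
  refine ⟨.ofFinset t h ht', Finset.univ, ?_⟩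
  change Finset.univ.image (t.orderEmbOfFin h) = t
  rw [← Finset.coe_inj, Finset.coe_image, Finset.coe_univ, Set.image_univ,
    Finset.range_orderEmbOfFin]

theorem glueFun_empty : glueFun s x ∅ = 0 := by
  rw [glueFun, dif_neg]
  simp

theorem glueFun_univ : glueFun s x Finset.univ = 0 := by
  rw [glueFun, dif_neg]
  simp

/-- For `n > 0` a vertex is a proper face, and the component there has the anchor of `x` since legs
of cones preserve anchors. -/
theorem anchor_glueFun_singleton [NeZero n] (i : Fin (n + 1)) :
    g.anchor (glueFun s x {i}) = s.pt.anchor x := by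
  obtain ⟨j, u, hu⟩ := exists_image_eq (Finset.singleton_nonempty i) (fun h => by
    have := congrArg Finset.card h
    simp [NeZero.ne n] at this)
  have hc : u.card = 1 := by
    rw [← Finset.card_image_of_injective u j.vertexMap_injective, hu, Finset.card_singleton]
  obtain ⟨a, rfl⟩ := Finset.card_eq_one.1 hc
  rw [← hu, glueFun_image, ← hatAnchor_faceValue s x j]
  exact (faceValue s x j).2.2.2 a 0

/-- The element of `Hom_{T_A}(C_*(Δⁿ; ℝ), g)` glued from an element of a cone over the matching
diagram. -/
noncomputable def glue [NeZero n] : g.hatCarrier n :=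
  ⟨glueFun s x, glueFun_empty s x, fun t ht => by
    -- The filler zero on the top simplex lies in the kernel of the anchor; all other values come
    -- from a component.
    by_cases ht' : t = Finset.univ
    · rw [ht', glueFun_univ, map_zero]
    · obtain ⟨j, u, rfl⟩ := exists_image_eq (Finset.card_pos.1 (by omega)) ht'
      rw [glueFun_image]
      refine (faceValue s x j).2.2.1 u ?_
      rwa [Finset.card_image_of_injective u j.vertexMap_injective] at ht,
    fun i j => by rw [anchor_glueFun_singleton, anchor_glueFun_singleton]⟩

theorem glue_mem [NeZero n] {k : ℤ} (hx : x ∈ s.pt.gr k) : glue s x ∈ g.hatGr n k := by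
  intro t
  change glueFun s x t ∈ _
  by_cases ht' : t = Finset.univ
  · rw [ht', glueFun_univ]
    exact zero_mem _
  rcases t.eq_empty_or_nonempty with rfl | ht
  · rw [glueFun_empty]
    exact zero_mem _
  obtain ⟨j, u, rfl⟩ := exists_image_eq ht ht'
  rw [glueFun_image, Finset.card_image_of_injective u j.vertexMap_injective]
  exact faceValue_mem s x hx j u

theorem hatMap_glue [NeZero n] (j : ProperFace n) :
    hatMap j.vertexMap (glue s x) = faceValue s x j := by
  apply Subtype.ext
  funext u
  change (if (u.image j.vertexMap).card = u.card then glueFun s x (u.image j.vertexMap) else 0) = _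
  rw [if_pos (Finset.card_image_of_injective u j.vertexMap_injective), glueFun_image]

theorem hat_hasLifts (hfib : g.IsFibrant) (hab : g.HasAbelianKernel) (n : ℕ) :
    HasLifts (g := hatObj n hab) (matchingCone (g.hat hab) n).π := by
  intro s k x hx
  rcases n with _ | n
  -- With no proper faces only the anchor is prescribed, and surjectivity of the anchor of `g`
  -- supplies a value at the single vertex.
  · obtain ⟨y, hy, h⟩ := hfib k _ (s.pt.anchor_mem k x hx)
    exact ⟨hatConst 0 y, hatConst_mem hy, fun j => isEmptyElim j.unop,
      (congrArg g.anchor (hatConst_vertex y 0)).trans h⟩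
  · exact ⟨glue s x, glue_mem s x hx, fun j => hatMap_glue s x j.unop,
      anchor_glueFun_singleton s x 0⟩

theorem hat_isReedyFibrant (hfib : g.IsFibrant) (hab : g.HasAbelianKernel) :
    IsReedyFibrant (g.hat hab) :=
  fun n => (hat_hasLifts hfib hab n).exists_fibration

end DGLieAlgebroid

/-! ### The contraction onto a vertex -/

namespace DGLieAlgebroid

variable {A : CDGA.{u}} {g : DGLieAlgebroid A} {n : ℕ}

/-- Precomposition with the contraction `s ↦ {0} ∪ s` of the simplex onto its vertex `0`. -/
def hatContract : g.hatCarrier n →ₗ[ℝ] g.hatCarrier n where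
  -- The empty set is excluded because `insert 0 ∅` is the vertex `{0}`, whereas functions are
  -- extended by zero to `∅`. All other values, even at vertices, are taken on faces of positive
  -- weight, so their anchors vanish.
  toFun f := ⟨fun s => if 0 ∈ s ∨ s = ∅ then 0 else f.1 (insert 0 s), by
    have h : ∀ s : Finset (Fin (n + 1)),
        g.anchor (if 0 ∈ s ∨ s = ∅ then 0 else f.1 (insert 0 s)) = 0 := by
      intro s
      split_ifs with hs
      · exact map_zero _
      · push Not at hs
        have := hs.2.card_pos
        exact f.2.2.1 _ (by rw [Finset.card_insert_of_notMem hs.1]; omega)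
    exact ⟨by simp, fun s _ => h s, fun i j => (h _).trans (h _).symm⟩⟩
  map_add' f f' := by
    apply Subtype.ext
    funext s
    change (if 0 ∈ s ∨ s = ∅ then 0 else f.1 (insert 0 s) + f'.1 (insert 0 s)) =
      (if 0 ∈ s ∨ s = ∅ then 0 else f.1 (insert 0 s)) +
        (if 0 ∈ s ∨ s = ∅ then 0 else f'.1 (insert 0 s))
    split_ifs <;> simp
  map_smul' c f := by
    apply Subtype.ext
    funext s
    change (if 0 ∈ s ∨ s = ∅ then 0 else c • f.1 (insert 0 s)) =
      c • (if 0 ∈ s ∨ s = ∅ then 0 else f.1 (insert 0 s))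
    split_ifs <;> simp

theorem hatContract_apply (f : g.hatCarrier n) {s : Finset (Fin (n + 1))} (h0 : 0 ∉ s)
    (hs : s.Nonempty) : (hatContract f).1 s = f.1 (insert 0 s) :=
  if_neg (by simp [h0, hs.ne_empty])

theorem hatContract_of_mem (f : g.hatCarrier n) {s : Finset (Fin (n + 1))} (h0 : 0 ∈ s) :
    (hatContract f).1 s = 0 :=
  if_pos (Or.inl h0)

theorem hatContract_mem {k l : ℤ} (hkl : l + 1 = k) {f : g.hatCarrier n} (hf : f ∈ g.hatGr n k) :
    hatContract f ∈ g.hatGr n l := by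
  intro s
  change (if 0 ∈ s ∨ s = ∅ then 0 else f.1 (insert 0 s)) ∈ _
  split_ifs with hs
  · exact zero_mem _
  · push Not at hs
    have := hf (insert 0 s)
    rw [Finset.card_insert_of_notMem hs.1] at this
    convert this using 2
    push_cast
    omega

/-- The contraction commutes with the internal differential, which therefore cancels. The boundary
terms carry the signs `(-1) ^ (p - 1)` and `(-1) ^ p`, so the commutator is `(-1) ^ p` times the
anticommutator of the contraction with the simplicial coboundary. The latter is the usual cone
formula: erasing `0` from `{0} ∪ s` leaves `s`, the other faces cancel, and for a vertex `s` the
remaining face `{0}` gives the constant term. -/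
theorem hatD_hatContract {p : ℤ} {f : g.hatCarrier n} (hf : f ∈ g.hatGr n p) :
    g.hatD n (hatContract f) - hatContract (g.hatD n f) =
      (-1 : ℝ) ^ p • (f - hatConst n (f.1 {0})) := by
  apply Subtype.ext
  funext s
  change (g.hatD n (hatContract f)).1 s - (hatContract (g.hatD n f)).1 s =
    (-1 : ℝ) ^ p • (f.1 s - (hatConst n (f.1 {0})).1 s)
  rcases s.eq_empty_or_nonempty with rfl | hs
  · rw [(g.hatD n _).2.1, (hatContract _).2.1, f.2.1, (hatConst n _).2.1]
    simp
  rw [hatD_apply (hatContract_mem (sub_add_cancel p 1) hf), zpow_sub_one₀ (by norm_num)]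
  by_cases h0 : 0 ∈ s
  -- Faces of `s` that still contain `0` contribute nothing; erasing `0` is the only surviving term,
  -- and the contraction puts `0` back.
  · rw [hatContract_of_mem _ h0, hatContract_of_mem _ h0, Finset.sum_eq_single_of_mem 0 h0]
    · have hp : facePos s 0 = 0 := by simp [facePos]
      rw [hp]
      by_cases hs1 : s.erase 0 = ∅
      · obtain rfl : s = {0} := by
          rw [← Finset.insert_erase h0, hs1]
          rfl
        rw [hs1, (hatContract f).2.1, hatConst_vertex]
        simp
      · have hc : 1 < s.card := by
          have := (Finset.nonempty_iff_ne_empty.2 hs1).card_pos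
          rw [Finset.card_erase_of_mem h0] at this
          omega
        rw [hatContract_apply _ (Finset.notMem_erase 0 s) (Finset.nonempty_iff_ne_empty.2 hs1),
          Finset.insert_erase h0, hatConst_pos _ hc]
        simp
    · intro r _ hr
      rw [hatContract_of_mem _ (Finset.mem_erase.2 ⟨hr.symm, h0⟩), smul_zero]
  · rw [hatContract_apply _ h0 hs, hatContract_apply _ h0 hs, hatD_apply hf,
      Finset.sum_insert h0, Finset.erase_insert h0]
    have hp : facePos (insert 0 s) 0 = 0 := by simp [facePos]
    have hsum : ∑ r ∈ s, (-1 : ℝ) ^ facePos (insert 0 s) r • f.1 ((insert 0 s).erase r) =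
        -(∑ r ∈ s, (-1 : ℝ) ^ facePos s r • (hatContract f).1 (s.erase r)) -
          (hatConst n (f.1 {0})).1 s := by
      -- Inserting the least vertex shifts every position by one, whence the overall minus sign in
      -- `hsum`.
      have hpos : ∀ r ∈ s, facePos (insert 0 s) r = facePos s r + 1 := by
        intro r hr
        have hr0 : 0 < r := Fin.pos_of_ne_zero fun h => h0 (h ▸ hr)
        rw [facePos, Finset.filter_insert, if_pos hr0, Finset.card_insert_of_notMem (by simp [h0])]
        rfl
      have her : ∀ r ∈ s, (insert 0 s).erase r = insert 0 (s.erase r) := fun r hr =>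
        Finset.erase_insert_of_ne fun h => h0 (h ▸ hr)
      -- For a vertex, erasing leaves `∅`, where the contraction is zero by convention although
      -- `insert 0 ∅ = {0}`; the value at `{0}` missed in this way is the correction term.
      by_cases hc : s.card = 1
      · obtain ⟨i, rfl⟩ := Finset.card_eq_one.1 hc
        have hi : facePos ({i} : Finset (Fin (n + 1))) i = 0 := by
          simp [facePos, Finset.filter_singleton]
        rw [Finset.sum_singleton, Finset.sum_singleton, hpos i (by simp), her i (by simp), hi,
          hatConst_vertex, Finset.erase_singleton, (hatContract f).2.1]
        simp
      · have hc' : 1 < s.card := lt_of_le_of_ne hs.card_pos (Ne.symm hc)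
        rw [hatConst_pos _ hc', sub_zero, ← Finset.sum_neg_distrib]
        refine Finset.sum_congr rfl fun r hr => ?_
        rw [hpos r hr, her r hr, hatContract_apply _ (fun h => h0 (Finset.mem_of_mem_erase h))
          (Finset.card_pos.1 (by rw [Finset.card_erase_of_mem hr]; omega)), pow_succ]
        module
    rw [hsum, hp]
    module

/-! ### Constant functions as a homotopy equivalence -/

/-- Evaluation at the vertex `0`, as a strict map. -/
noncomputable def hatEval (hab : g.HasAbelianKernel) (n : ℕ) :
    (hatObj n hab).toLInf ⟶ g.toLInf :=
  homMk (g := hatObj n hab)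
    { toFun := fun f => f.1 {0}
      map_add' := fun _ _ => rfl
      map_smul' := fun _ _ => rfl }
    (fun _ _ hf => hatGr_vertex hf 0) (fun f => hatD_vertex f 0) (fun f h => hatLie_vertex f h 0)
    (fun _ => rfl)

/-- The inclusion of the constant functions, as a strict map. -/
noncomputable def hatConstHom (hab : g.HasAbelianKernel) (n : ℕ) :
    g.toLInf ⟶ (hatObj n hab).toLInf :=
  homMk (h := hatObj n hab) (hatConst n) (fun _ _ => hatConst_mem) hatConst_d
    hatConst_lie (fun x => congrArg g.anchor (hatConst_vertex x 0))

/-- The contraction as a map between homogeneous parts. -/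
noncomputable def hatContractHom (hab : g.HasAbelianKernel) (n : ℕ) {k l : ℤ} (h : l + 1 = k) :
    (hatObj n hab).toLInf.toDGModule.complex.X k ⟶ (hatObj n hab).toLInf.toDGModule.complex.X l :=
  -- The alternating sign turns the commutator of `hatD_hatContract` into the anticommutator
  -- required of a homotopy; the extra minus sign gives the direction from the constant retraction
  -- to the identity.
  ModuleCat.ofHom (-(-1 : ℝ) ^ k •
    hatContract.restrict (p := g.hatGr n k) (q := g.hatGr n l) fun _ hf => hatContract_mem h hf)

/-- The homotopy from evaluation at a vertex to the identity. -/
noncomputable def hatHomotopy (hab : g.HasAbelianKernel) (n : ℕ) :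
    Homotopy ((hatEval hab n).complexMap ≫ (hatConstHom hab n).complexMap)
      (𝟙 (hatObj n hab).toLInf.toDGModule.complex) where
  hom i j := if h : j + 1 = i then hatContractHom hab n h else 0
  zero i j h := dif_neg h
  comm i := by
    -- Writing the degree as a successor lets both index conditions in the homotopy hold by
    -- reflexivity.
    obtain ⟨i, rfl⟩ : ∃ j, i = j + 1 := ⟨i - 1, by ring⟩
    have hd : ∀ k, (hatObj n hab).toLInf.toDGModule.complex.d k (k + 1) =
        ModuleCat.ofHom ((g.hatD n).restrict fun _ hf => hatD_mem hf) :=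
      fun k => by
        simp only [DGModule.complex, CochainComplex.of_d]
        rfl
    rw [dNext_eq _ (show (ComplexShape.up ℤ).Rel (i + 1) (i + 1 + 1) from rfl),
      prevD_eq _ (show (ComplexShape.up ℤ).Rel i (i + 1) from rfl), dif_pos rfl, dif_pos rfl,
      hd, hd]
    have key : ∀ f ∈ g.hatGr n (i + 1), hatConst n (f.1 {0}) =
        -(-1 : ℝ) ^ (i + 1 + 1) • hatContract (g.hatD n f) +
          g.hatD n (-(-1 : ℝ) ^ (i + 1) • hatContract f) + f := by
      intro f hf
      rw [map_smul, zpow_add_one₀ (by norm_num) (i + 1),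
        sub_eq_iff_eq_add.1 (hatD_hatContract hf)]
      rcases neg_one_zpow_cases (i + 1) with h | h <;> rw [h] <;> module
    refine ModuleCat.hom_ext (LinearMap.ext fun f => Subtype.ext ?_)
    exact key f.1 f.2

/-- The homotopy equivalence of complexes given by the constant functions and evaluation at a
vertex. -/
noncomputable def hatHomotopyEquiv (hab : g.HasAbelianKernel) (n : ℕ) :
    HomotopyEquiv g.toLInf.toDGModule.complex (hatObj n hab).toLInf.toDGModule.complex where
  hom := (hatConstHom hab n).complexMap
  inv := (hatEval hab n).complexMap
  homotopyHomInvId := Homotopy.ofEq (by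
    ext i x
    exact Subtype.ext (hatConst_vertex (n := n) x.1 0))
  homotopyInvHomId := hatHomotopy hab n

/-- Each component of the augmentation is by definition `hatConstHom`, the forward map of a homotopy
equivalence. -/
theorem weakEquivalence_hatAugmentation (hab : g.HasAbelianKernel) (Δ : SimplexCategoryᵒᵖ) :
    WeakEquivalence ((g.hatAugmentation hab).app Δ) :=
  (weakEquivalence_iff _).2
    (inferInstanceAs (QuasiIso (hatHomotopyEquiv hab Δ.unop.len).hom))

end DGLieAlgebroid

theorem theoremE9 (A : CDGA.{u}) (g : DGLieAlgebroid A) (hfib : g.IsFibrant)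
    (hab : g.HasAbelianKernel) :
    IsFibrantSimplicialResolution (g.hatAugmentation hab) :=
  ⟨DGLieAlgebroid.hat_isReedyFibrant hfib hab, DGLieAlgebroid.weakEquivalence_hatAugmentation hab⟩
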